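/- Let $q\ge 2$, $L>0$ and $c_1,c_2>0$. Let $\gamma:\mathbb{R}/L\mathbb{Z}\to\mathbb{R}^3$ be an injective $C^{1,1}$ curve (i.e. $C^1$ with Lipschitz derivative) parametrized by arclength, and let $$\mathrm{TP}_q(\gamma)=\iint_{(\mathbb{R}/L\mathbb{Z})^2}\Big(\frac{2\,\mathrm{dist}(\gamma(s)+\mathbb{R}\gamma'(s),\gamma(t))}{|\gamma(s)-\gamma(t)|^2}\Big)^q\,ds\,dt$$ be its tangent-point energy. For $n\ge 2$ let $0=s_{n,0}<s_{n,1}<\dots<s_{n,n}=L$ be partitions with $\frac{c_1}{n}\le s_{n,k+1}-s_{n,k}\le\frac{c_2}{n}$ and $s_{n,k+1}-s_{n,k}\le\frac L2$ for all $0\le k<n$. A biarc is a pair of circular arcs (straight segments being allowed, full circles not), joined with continuous unit tangent at a matching point $m$. It interpolates the point-tangent pair $([q_0,t_0],[q_1,t_1])$, with $q_0\ne q_1$ and $|t_0|=|t_1|=1$, if it runs from $q_0$ to $q_1$ with unit tangent $t_0$ at $q_0$ and $t_1$ at $q_1$. Put $e=\frac{q_1-q_0}{|q_1-q_0|}$ and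 $t_1^*=2\langle e,t_1\rangle e-t_1$; if $t_0+t_1^*\ne0$, let $\Sigma_{++}$ be the open arc from $q_0$ to $q_1$, oriented by $t_0+t_1^*$, of the circle (or line) through $q_0$ and $q_1$ with tangent $t_0+t_1^*$ at $q_0$. The biarc is proper if $\langle q_1-q_0,t_0\rangle>0$, $\langle q_1-q_0,t_1\rangle>0$ and $m\in\Sigma_{++}$, and it is balanced if $m\in\Sigma_{++}$ and $|m-q_0|=|q_1-m|$. Let $\tilde{\mathcal B}_n$ be the set of closed regular $C^1$ curves $\beta$ that are assembled from $n$ consecutive biarcs (the decomposition being part of the datum); write $q_i$ and $t_i$ for the initial point and initial unit tangent, and $\lambda_i$ for the length, of the $i$-th biarc, $0\le i<n$. Put $$\tilde{\mathcal E}_q^n(\beta)=\sum_{i=0}^{n-1}\sum_{\substack{j=0\\ j\ne i}}^{n-1}\Big(\frac{2\,\mathrm{dist}(q_j+\mathbb{R}t_j,q_i)}{|q_i-q_j|^2}\Big)^q\lambda_i\lambda_j\quad\text{if }\beta\in\tilde{\mathcal B}_n,\qquad \tilde{\mathcal E}_q^n(\beta)=\infty\quad\text{otherwise.}$$ Let $n_0\in\mathbb{N}$,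 and for every $n\ge n_0$ let $\beta_n\in\tilde{\mathcal B}_n$ be a biarc curve whose $i$-th biarc is proper, balanced, and interpolates $([\gamma(s_{n,i}),\gamma'(s_{n,i})],[\gamma(s_{n,i+1}),\gamma'(s_{n,i+1})])$ for each $i=0,\dots,n-1$. Then $\mathrm{TP}_q(\gamma)<\infty$, and there is an $N\in\mathbb{N}$ such that for every $\varepsilon>0$ there is a constant $C_\varepsilon>0$ with $$\tilde{\mathcal E}_q^n(\beta_n)<\infty\quad\text{and}\quad\big|\mathrm{TP}_q(\gamma)-\tilde{\mathcal E}_q^n(\beta_n)\big|\le\frac{C_\varepsilon}{n^{1-\varepsilon}}\qquad\text{for all } n\ge N.$$ -/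

import Mathlib

open MeasureTheory

noncomputable section

/-- Euclidean three-space. -/
abbrev E3 : Type := EuclideanSpace ℝ (Fin 3)

/-- The class `C^{1,1}_ia(ℝ/Lℤ, ℝ³)`: maps `γ` on `ℝ/Lℤ` (that is, `L`-periodic maps on `ℝ`)
that are continuously differentiable with Lipschitz derivative, injective on `ℝ/Lℤ`, and
parametrized by arclength. -/
structure IsC11ia (L : ℝ) (γ : ℝ → E3) : Prop where
  periodic : Function.Periodic γ L
  contDiff : ContDiff ℝ 1 γ
  lipschitz : ∃ K : NNReal, LipschitzWith K (deriv γ)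
  injective : Set.InjOn γ (Set.Ico 0 L)
  arclength : ∀ s, ‖deriv γ s‖ = 1

/-- The straight line `p + ℝ t`. -/
def tangentLine (p t : E3) : Set E3 := Set.range fun μ : ℝ => p + μ • t

/-- The reciprocal `1 / r_tp = 2 dist(p + ℝ t, x) / |p - x|²` of the tangent-point radius: the
radius of the circle through `p` and `x` that is tangent to `t` at `p`. -/
def invTangentPointRadius (p t x : E3) : ℝ :=
  2 * Metric.infDist x (tangentLine p t) / ‖p - x‖ ^ 2

/-- The tangent-point energy `TP_q` of an arclength parametrized curve `γ` on `ℝ/Lℤ`. -/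
def tangentPointEnergy (q L : ℝ) (γ : ℝ → E3) : ENNReal :=
  ∫⁻ s in Set.Ioc 0 L, ∫⁻ t in Set.Ioc 0 L,
    ENNReal.ofReal (invTangentPointRadius (γ s) (deriv γ s) (γ t) ^ q)

/-- A `(c₁-c₂)`-distributed sequence of partitions `0 = s n 0 < s n 1 < ⋯ < s n n = L`. (A
partition into one interval cannot have mesh at most `L/2`, so the sequence starts at `n = 2`.) -/
def IsDistributed (L c₁ c₂ : ℝ) (s : ℕ → ℕ → ℝ) : Prop :=
  ∀ n, 2 ≤ n → s n 0 = 0 ∧ s n n = L ∧ ∀ k < n,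
    s n k < s n (k + 1) ∧ c₁ / n ≤ s n (k + 1) - s n k ∧
      s n (k + 1) - s n k ≤ c₂ / n ∧ s n (k + 1) - s n k ≤ L / 2

/-- The length of the curve `β` between the parameters `a` and `b`. -/
def arcLen (β : ℝ → E3) (a b : ℝ) : ℝ := ∫ τ in a..b, ‖deriv β τ‖

/-- The unit tangent of a regular curve. -/
def unitTangent (β : ℝ → E3) (τ : ℝ) : E3 := ‖deriv β τ‖⁻¹ • deriv β τ

/-- For a unit vector `t` and a vector `k` orthogonal to `t`, the map `τ ↦ circlePoint p t k τ` is
the arclength parametrization of the circle of curvature `‖k‖` that starts at `p` in the direction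
`t` and has curvature vector `k` at `p`. For `k = 0` it is the straight line through `p` in
direction `t`. -/
def circlePoint (p t k : E3) (τ : ℝ) : E3 :=
  if k = 0 then p + τ • t
  else p + (Real.sin (‖k‖ * τ) / ‖k‖) • t + ((1 - Real.cos (‖k‖ * τ)) / ‖k‖ ^ 2) • k

/-- On `[a, b]`, the regular curve `β` runs once along a circular arc, which is less than a full
circle (a straight segment counts as an arc of curvature zero). -/
def IsCircularArcOn (β : ℝ → E3) (a b : ℝ) : Prop :=
  ∃ k : E3, inner ℝ (unitTangent β a) k = 0 ∧ ‖k‖ * arcLen β a b < 2 * Real.pi ∧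
    ∀ τ ∈ Set.Icc a b, β τ = circlePoint (β a) (unitTangent β a) k (arcLen β a τ)

/-- On `[a, b]`, the regular `C¹` curve `β` runs along a biarc with matching point `β c`, which
interpolates the point-tangent data of `β` at `a` and `b`. -/
def IsBiarcOn (β : ℝ → E3) (a c b : ℝ) : Prop :=
  a < c ∧ c < b ∧ β a ≠ β b ∧ IsCircularArcOn β a c ∧ IsCircularArcOn β c b

/-- The reflection `R(e) t = 2 ⟨e, t⟩ e - t` with `e = (q₁ - q₀) / |q₁ - q₀|`. -/
def reflTangent (q₀ q₁ t : E3) : E3 :=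
  (2 * inner ℝ (‖q₁ - q₀‖⁻¹ • (q₁ - q₀)) t) • (‖q₁ - q₀‖⁻¹ • (q₁ - q₀)) - t

/-- The desired matching point location `Σ₊₊` of a point-tangent pair that is not incompatible
cocircular, i.e. `t₀ + t₁* ≠ 0`: the open subarc from `q₀` to `q₁` of the circle (or line) `C₊`
through `q₀` and `q₁` with tangent `t₀ + t₁*` at `q₀`, oriented by that tangent. -/
def sigmaPlusPlus (q₀ t₀ q₁ t₁ : E3) : Set E3 :=
  let w := t₀ + reflTangent q₀ q₁ t₁
  {m | w ≠ 0 ∧ ∃ (k : E3) (l : ℝ), inner ℝ w k = 0 ∧ 0 < l ∧ ‖k‖ * l < 2 * Real.pi ∧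
    circlePoint q₀ (‖w‖⁻¹ • w) k l = q₁ ∧
    ∃ τ ∈ Set.Ioo 0 l, m = circlePoint q₀ (‖w‖⁻¹ • w) k τ}

/-- A curve together with marked parameters: `node i` (the junctions of consecutive biarcs) and
`mid i` (the matching points). The marking is part of the datum, because the same curve may be
decomposed into biarcs in several ways. -/
structure MarkedCurve where
  /-- the curve -/
  toFun : ℝ → E3
  /-- the parameters of the junctions -/
  node : ℕ → ℝ
  /-- the parameters of the matching points -/
  mid : ℕ → ℝ

namespace MarkedCurve

/-- The point `q_i`. -/
def pt (β : MarkedCurve) (i : ℕ) : E3 := β.toFun (β.node i)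

/-- The unit tangent `t_i` at `q_i`. -/
def tan (β : MarkedCurve) (i : ℕ) : E3 := unitTangent β.toFun (β.node i)

/-- The matching point of the `i`-th biarc. -/
def matching (β : MarkedCurve) (i : ℕ) : E3 := β.toFun (β.mid i)

/-- The length `λ_i` of the `i`-th biarc. -/
def biarcLen (β : MarkedCurve) (i : ℕ) : ℝ := arcLen β.toFun (β.node i) (β.node (i + 1))

/-- The set of closed biarc curves consisting of `n` biarcs: closed regular `C¹` curves (extended
periodically from `[node 0, node n]` to `ℝ`) that run along a biarc between consecutive nodes. -/
def biarcCurves (n : ℕ) : Set MarkedCurve :=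
  {β | 1 ≤ n ∧ Function.Periodic β.toFun (β.node n - β.node 0) ∧ ContDiff ℝ 1 β.toFun ∧
    (∀ τ, deriv β.toFun τ ≠ 0) ∧
    ∀ i < n, IsBiarcOn β.toFun (β.node i) (β.mid i) (β.node (i + 1))}

/-- The matching point of the `i`-th biarc lies in the desired location `Σ₊₊`. -/
def MatchingInSigma (β : MarkedCurve) (i : ℕ) : Prop :=
  β.matching i ∈ sigmaPlusPlus (β.pt i) (β.tan i) (β.pt (i + 1)) (β.tan (i + 1))

/-- All `n` biarcs are proper: they interpolate proper point-tangent pairs, with matching points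
in `Σ₊₊`. -/
def IsProper (n : ℕ) (β : MarkedCurve) : Prop :=
  ∀ i < n, 0 < inner ℝ (β.pt (i + 1) - β.pt i) (β.tan i) ∧
    0 < inner ℝ (β.pt (i + 1) - β.pt i) (β.tan (i + 1)) ∧ β.MatchingInSigma i

/-- The `i`-th biarc interpolates `([γ a, γ' a], [γ b, γ' b])`. -/
def InterpolatesAt (β : MarkedCurve) (γ : ℝ → E3) (i : ℕ) (a b : ℝ) : Prop :=
  β.pt i = γ a ∧ β.tan i = deriv γ a ∧ β.pt (i + 1) = γ b ∧ β.tan (i + 1) = deriv γ b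

/-- All `n` biarcs are `γ`-interpolating and balanced. -/
def IsInterpolatingBalanced (n : ℕ) (γ : ℝ → E3) (β : MarkedCurve) : Prop :=
  ∀ i < n, (∃ a h : ℝ, 0 < h ∧ β.InterpolatesAt γ i a (a + h)) ∧ β.MatchingInSigma i ∧
    ‖β.matching i - β.pt i‖ = ‖β.pt (i + 1) - β.matching i‖

open Classical in
/-- The discrete tangent-point energy, with effective domain the set of all closed biarc curves
consisting of `n` biarcs. -/
def discreteEnergy (q : ℝ) (n : ℕ) (β : MarkedCurve) : ENNReal :=
  if β ∈ biarcCurves n then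
    ENNReal.ofReal (∑ i ∈ Finset.range n, ∑ j ∈ (Finset.range n).erase i,
      invTangentPointRadius (β.pt j) (β.tan j) (β.pt i) ^ q * (β.biarcLen i * β.biarcLen j))
  else ⊤

end MarkedCurve

end

/-! A `C^{1,1}` curve leaves its tangent line only quadratically in chord length
(`IsC11ia.exists_chord_bounds`), so the kernel `tpKernel` is bounded and the energy is finite. The
kernel need not extend continuously to the diagonal, but moving both arguments by at most `η`
changes it by at most `C η / ‖γ s - γ t‖` (`IsC11ia.exists_tpKernel_bounds`).

On a cell of side `O(1/n)` at cyclic index distance `k` from the diagonal the chord is at least of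
order `k/n`, so the kernel oscillates by `O(1/k)` there. Each row of cells thus contributes `O(n⁻²
log n)`, the diagonal cells `O(n⁻²)` each, and the off-diagonal Riemann sum misses the integral by
`O(log n / n)` (`IsC11ia.exists_riemann_error_le`).

It remains to exchange parameter steps for biarc lengths. A biarc is at least as long as its chord.
Conversely, balance and the position of the matching point on `Σ₊₊` keep both half chords close to
the full chord, and each arc is controlled by its own chord (`biarc_length_le`). Hence `λ = h +
O(h²)` (`IsC11ia.exists_abs_biarcLen_sub_le`). This alters each of the `n²` products of lengths by
`O(n⁻³)`, a total of `O(1/n)`. Finally `log n ≤ n^ε / ε`. -/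

noncomputable section

/-! ### Orthogonal components and the tangent-point radius -/

/-- The component of `v` orthogonal to the unit vector `t`. -/
def perp (t v : E3) : E3 := v - (inner ℝ t v : ℝ) • t

lemma perp_sub (t v w : E3) : perp t (v - w) = perp t v - perp t w := by
  simp only [perp, inner_sub_right, sub_smul]; abel

/-- Pythagoras: `v - μ • t` differs from `perp t v` by a multiple of `t`. This turns Taylor
estimates into bounds for the distance to a tangent line. -/
lemma norm_perp_le_norm_sub_smul {t : E3} (ht : ‖t‖ = 1) (v : E3) (μ : ℝ) :
    ‖perp t v‖ ≤ ‖v - μ • t‖ := by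
  have htt : (inner ℝ t t : ℝ) = 1 := by rw [real_inner_self_eq_norm_sq, ht]; norm_num
  have hv : v - μ • t = perp t v + ((inner ℝ t v : ℝ) - μ) • t := by
    simp only [perp, sub_smul]; abel
  have horth : (inner ℝ (perp t v) (((inner ℝ t v : ℝ) - μ) • t) : ℝ) = 0 := by
    simp only [perp, inner_sub_left, inner_smul_left, inner_smul_right, htt, real_inner_comm t v]
    simp
  have h := norm_add_sq_eq_norm_sq_add_norm_sq_of_inner_eq_zero _ _ horth
  rw [hv]
  nlinarith [norm_nonneg (perp t v), norm_nonneg (perp t v + ((inner ℝ t v : ℝ) - μ) • t),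
    mul_self_nonneg ‖((inner ℝ t v : ℝ) - μ) • t‖]

lemma norm_perp_sub_perp_le {t t' : E3} (ht : ‖t‖ = 1) (ht' : ‖t'‖ = 1) (v : E3) :
    ‖perp t v - perp t' v‖ ≤ 2 * ‖t - t'‖ * ‖v‖ := by
  have h : perp t v - perp t' v =
      -((inner ℝ t v : ℝ) • (t - t') + (inner ℝ (t - t') v : ℝ) • t') := by
    simp only [perp, inner_sub_left, sub_smul, smul_sub]; abel
  rw [h, norm_neg]
  refine (norm_add_le _ _).trans ?_
  rw [norm_smul, norm_smul, ht', Real.norm_eq_abs, Real.norm_eq_abs]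
  have h1 := abs_real_inner_le_norm t v
  have h2 := abs_real_inner_le_norm (t - t') v
  rw [ht] at h1
  nlinarith [norm_nonneg (t - t')]

lemma infDist_tangentLine {t : E3} (ht : ‖t‖ = 1) (p x : E3) :
    Metric.infDist x (tangentLine p t) = ‖perp t (x - p)‖ := by
  have hne : (tangentLine p t).Nonempty := Set.range_nonempty _
  apply le_antisymm
  · have hmem : p + (inner ℝ t (x - p) : ℝ) • t ∈ tangentLine p t := ⟨_, rfl⟩
    refine (Metric.infDist_le_dist_of_mem hmem).trans (le_of_eq ?_)
    rw [dist_eq_norm, perp]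
    congr 1; abel
  · rw [Metric.le_infDist hne]
    rintro _ ⟨μ, rfl⟩
    refine (norm_perp_le_norm_sub_smul ht (x - p) μ).trans (le_of_eq ?_)
    rw [dist_eq_norm, sub_sub]

lemma invTangentPointRadius_eq {t : E3} (ht : ‖t‖ = 1) (p x : E3) :
    invTangentPointRadius p t x = 2 * ‖perp t (x - p)‖ / ‖p - x‖ ^ 2 := by
  rw [invTangentPointRadius, infDist_tangentLine ht]

lemma invTangentPointRadius_nonneg (p t x : E3) : 0 ≤ invTangentPointRadius p t x := by
  unfold invTangentPointRadius
  have := Metric.infDist_nonneg (x := x) (s := tangentLine p t)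
  positivity

/-! ### Circular arcs -/

/-- This is `x ≤ tan x` below `π / 2`, while the cosine is nonpositive beyond. The range up to `π`
is that of half the central angle of an arc short of a full circle. -/
lemma mul_cos_le_sin {x : ℝ} (h0 : 0 ≤ x) (hπ : x ≤ Real.pi) : x * Real.cos x ≤ Real.sin x := by
  rcases lt_or_ge x (Real.pi / 2) with h | h
  · have hc : 0 < Real.cos x := Real.cos_pos_of_mem_Ioo ⟨by linarith [Real.pi_pos], h⟩
    have := Real.le_tan h0 h
    rwa [Real.tan_eq_sin_div_cos, le_div_iff₀ hc] at this
  · have hc : Real.cos x ≤ 0 := Real.cos_nonpos_of_pi_div_two_le_of_le h (by linarith)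
    have hs := Real.sin_nonneg_of_nonneg_of_le_pi h0 hπ
    nlinarith

/-- The unit tangent of `circlePoint p t k` at `τ`. -/
def circleTangent (t k : E3) (τ : ℝ) : E3 :=
  Real.cos (‖k‖ * τ) • t + (Real.sin (‖k‖ * τ) / ‖k‖) • k

lemma hasDerivAt_circlePoint (p t k : E3) (τ : ℝ) :
    HasDerivAt (circlePoint p t k) (circleTangent t k τ) τ := by
  by_cases hk : k = 0
  · have : circlePoint p t k = fun τ => p + τ • t := by ext1 τ; simp [circlePoint, hk]
    rw [this]
    simpa [circleTangent, hk] using ((hasDerivAt_id τ).smul_const t).const_add p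
  · have hk' : ‖k‖ ≠ 0 := norm_ne_zero_iff.2 hk
    have : circlePoint p t k = fun τ => p + (Real.sin (‖k‖ * τ) / ‖k‖) • t
        + ((1 - Real.cos (‖k‖ * τ)) / ‖k‖ ^ 2) • k := by ext1 τ; simp [circlePoint, hk]
    rw [this]
    have hl : HasDerivAt (fun τ : ℝ => ‖k‖ * τ) ‖k‖ τ := by
      simpa using (hasDerivAt_id τ).const_mul ‖k‖
    have h1 : HasDerivAt (fun τ => (Real.sin (‖k‖ * τ) / ‖k‖) • t) (Real.cos (‖k‖ * τ) • t) τ := by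
      have h := (hl.sin.div_const ‖k‖).smul_const t
      rwa [mul_div_cancel_right₀ _ hk'] at h
    have h2 : HasDerivAt (fun τ => ((1 - Real.cos (‖k‖ * τ)) / ‖k‖ ^ 2) • k)
        ((Real.sin (‖k‖ * τ) / ‖k‖) • k) τ := by
      have h := ((hl.cos.const_sub 1).div_const (‖k‖ ^ 2)).smul_const k
      have e : -(-Real.sin (‖k‖ * τ) * ‖k‖) / ‖k‖ ^ 2 = Real.sin (‖k‖ * τ) / ‖k‖ := by field_simp
      rwa [e] at h
    exact (h1.const_add p).add h2

/-- Half-angle formulas: with half central angle `x`, the chord has signed length `2 sin x / ‖k‖`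
and makes the angle `x` with `t`. -/
lemma circlePoint_sub_eq {k : E3} (hk : k ≠ 0) (p t : E3) (τ : ℝ) :
    circlePoint p t k τ - p = (2 * Real.sin (‖k‖ * τ / 2) / ‖k‖) •
      (Real.cos (‖k‖ * τ / 2) • t + (Real.sin (‖k‖ * τ / 2) / ‖k‖) • k) := by
  have hk' : ‖k‖ ≠ 0 := norm_ne_zero_iff.2 hk
  have e : ‖k‖ * τ = 2 * (‖k‖ * τ / 2) := by ring
  set x := ‖k‖ * τ / 2
  rw [circlePoint, if_neg hk, e, Real.sin_two_mul, Real.cos_two_mul, smul_add, smul_smul, smul_smul]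
  have h1 : 2 * Real.sin x * Real.cos x / ‖k‖ = 2 * Real.sin x / ‖k‖ * Real.cos x := by ring
  have h2 : (1 - (2 * Real.cos x ^ 2 - 1)) / ‖k‖ ^ 2
      = 2 * Real.sin x / ‖k‖ * (Real.sin x / ‖k‖) := by
    have := Real.sin_sq_add_cos_sq x
    rw [div_mul_div_comm, ← sq]
    congr 1
    linarith
  rw [h1, h2]; abel

lemma inner_frame {t k : E3} (ht : ‖t‖ = 1) (hk : k ≠ 0) (htk : (inner ℝ t k : ℝ) = 0)
    (a b c d : ℝ) :
    (inner ℝ (a • t + (b / ‖k‖) • k) (c • t + (d / ‖k‖) • k) : ℝ) = a * c + b * d := by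
  have hk' : ‖k‖ ≠ 0 := norm_ne_zero_iff.2 hk
  have hkt : (inner ℝ k t : ℝ) = 0 := by rw [real_inner_comm]; exact htk
  simp only [inner_add_left, inner_add_right, real_inner_smul_left, real_inner_smul_right, htk, hkt,
    real_inner_self_eq_norm_sq, ht]
  field_simp
  ring

lemma circlePoint_sub_of_zero (p t : E3) (τ : ℝ) : circlePoint p t 0 τ - p = τ • t := by
  simp [circlePoint]

/-- Both end tangents make the angle `x`, half the central angle, with the chord. As the arc length
is `2x / ‖k‖` and the chord `2 sin x / ‖k‖`, both claims reduce to `x cos x ≤ sin x`. They bound an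
arc length by chord over cosine without any inverse trigonometric function. -/
lemma length_mul_inner_le_norm_sq {t k : E3} (ht : ‖t‖ = 1) (htk : (inner ℝ t k : ℝ) = 0) (p : E3)
    {l : ℝ} (hl : 0 ≤ l) (hkl : ‖k‖ * l < 2 * Real.pi) :
    l * (inner ℝ t (circlePoint p t k l - p) : ℝ) ≤ ‖circlePoint p t k l - p‖ ^ 2 ∧
    l * (inner ℝ (circleTangent t k l) (circlePoint p t k l - p) : ℝ)
      ≤ ‖circlePoint p t k l - p‖ ^ 2 := by
  by_cases hk : k = 0
  · subst hk
    rw [circlePoint_sub_of_zero]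
    simp [circleTangent, real_inner_smul_right, norm_smul, ht, sq]
  · have hk' : 0 < ‖k‖ := norm_pos_iff.2 hk
    have e : ‖k‖ * l = 2 * (‖k‖ * l / 2) := by ring
    rw [← real_inner_self_eq_norm_sq, circlePoint_sub_eq hk, circleTangent]
    set x := ‖k‖ * l / 2 with hx
    rw [e, real_inner_smul_right, real_inner_smul_right, real_inner_smul_left,
      real_inner_smul_right, inner_frame ht hk htk, inner_frame ht hk htk]
    have h1 := inner_frame ht hk htk 1 0 (Real.cos x) (Real.sin x)
    simp only [one_smul, zero_div, zero_smul, add_zero, one_mul, zero_mul] at h1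
    rw [h1]
    have hx0 : 0 ≤ x := by positivity
    have hxπ : x ≤ Real.pi := by linarith
    have h2 := mul_cos_le_sin hx0 hxπ
    have hs := Real.sin_nonneg_of_nonneg_of_le_pi hx0 hxπ
    have hl' : l = 2 * x / ‖k‖ := by rw [hx]; field_simp
    have h3 : Real.cos (2 * x) * Real.cos x + Real.sin (2 * x) * Real.sin x = Real.cos x := by
      rw [← Real.cos_sub]; congr 1; ring
    have h4 : Real.cos x * Real.cos x + Real.sin x * Real.sin x = 1 := by
      nlinarith [Real.sin_sq_add_cos_sq x]
    rw [h3, h4]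
    have key : l * (2 * Real.sin x / ‖k‖ * Real.cos x)
        ≤ 2 * Real.sin x / ‖k‖ * (2 * Real.sin x / ‖k‖ * 1) := by
      have : l * (2 * Real.sin x / ‖k‖ * Real.cos x)
        = 2 * Real.sin x / ‖k‖ * (2 / ‖k‖ * (x * Real.cos x)) := by rw [hl']; ring
      rw [this]
      have : 2 * Real.sin x / ‖k‖ * 1 = 2 / ‖k‖ * Real.sin x := by ring
      rw [this]
      gcongr
    exact ⟨key, key⟩

/-- A chord of an arc makes a smaller angle with the full chord than the initial tangent does. -/
lemma norm_mul_inner_le_inner_chord {t k : E3} (ht : ‖t‖ = 1) (htk : (inner ℝ t k : ℝ) = 0) (p : E3)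
    {l τ : ℝ} (hτ : τ ∈ Set.Ioo 0 l) (hkl : ‖k‖ * l < 2 * Real.pi) :
    ‖circlePoint p t k τ - p‖ * (inner ℝ t (circlePoint p t k l - p) : ℝ) ≤
      inner ℝ (circlePoint p t k τ - p) (circlePoint p t k l - p) ∧
    circlePoint p t k τ ≠ p := by
  obtain ⟨hτ0, hτl⟩ := hτ
  rw [← sub_ne_zero (b := p)]
  by_cases hk : k = 0
  · subst hk
    rw [circlePoint_sub_of_zero, circlePoint_sub_of_zero]
    refine ⟨?_, smul_ne_zero hτ0.ne' (norm_ne_zero_iff.1 (by rw [ht]; norm_num))⟩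
    rw [real_inner_smul_left, norm_smul, ht, Real.norm_eq_abs, abs_of_pos hτ0, mul_one]
  · have hk' : 0 < ‖k‖ := norm_pos_iff.2 hk
    rw [circlePoint_sub_eq hk, circlePoint_sub_eq hk]
    have hyx : ‖k‖ * τ / 2 < ‖k‖ * l / 2 := by gcongr
    have hy0 : 0 < ‖k‖ * τ / 2 := by positivity
    have hxπ : ‖k‖ * l / 2 < Real.pi := by linarith
    set x := ‖k‖ * l / 2
    set y := ‖k‖ * τ / 2
    have hsy := Real.sin_pos_of_pos_of_lt_pi hy0 (by linarith)
    have hsx := Real.sin_pos_of_pos_of_lt_pi (hy0.trans hyx) hxπ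
    have hu : ‖Real.cos y • t + (Real.sin y / ‖k‖) • k‖ = 1 := by
      have := inner_frame ht hk htk (Real.cos y) (Real.sin y) (Real.cos y) (Real.sin y)
      rw [real_inner_self_eq_norm_sq] at this
      have h4 : Real.cos y * Real.cos y + Real.sin y * Real.sin y = 1 := by
        nlinarith [Real.sin_sq_add_cos_sq y]
      rw [h4] at this
      nlinarith [norm_nonneg (Real.cos y • t + (Real.sin y / ‖k‖) • k)]
    have ha : 0 < 2 * Real.sin y / ‖k‖ := by positivity
    refine ⟨?_, smul_ne_zero ha.ne' (norm_ne_zero_iff.1 (by rw [hu]; norm_num))⟩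
    have h1 := inner_frame ht hk htk 1 0 (Real.cos x) (Real.sin x)
    simp only [one_smul, zero_div, zero_smul, add_zero, one_mul, zero_mul] at h1
    rw [norm_smul, hu, real_inner_smul_left, real_inner_smul_right, real_inner_smul_right, h1,
      inner_frame ht hk htk, Real.norm_eq_abs, abs_of_pos ha, mul_one, ← Real.cos_sub]
    gcongr
    -- The two chords enclose the angle `x - y`, which is smaller than the angle `x` between `t` and
    -- the full chord.
    rw [← Real.cos_neg (y - x), neg_sub]
    exact Real.cos_le_cos_of_nonneg_of_le_pi (by linarith) hxπ.le (by linarith)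

/-! ### The length of a balanced biarc -/

lemma norm_sub_sq_unit {x y : E3} (hx : ‖x‖ = 1) (hy : ‖y‖ = 1) :
    ‖x - y‖ ^ 2 = 2 - 2 * (inner ℝ x y : ℝ) := by
  rw [norm_sub_sq_real, hx, hy]; ring

/-- The reflection is an isometry fixing the chord direction `e`. -/
lemma norm_reflTangent_sub {q₀ q₁ : E3} (h : q₀ ≠ q₁) (t : E3) :
    ‖reflTangent q₀ q₁ t - ‖q₁ - q₀‖⁻¹ • (q₁ - q₀)‖ = ‖t - ‖q₁ - q₀‖⁻¹ • (q₁ - q₀)‖ := by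
  have he : ‖‖q₁ - q₀‖⁻¹ • (q₁ - q₀)‖ = 1 := by
    rw [norm_smul, norm_inv, norm_norm, inv_mul_cancel₀]
    exact norm_ne_zero_iff.2 (sub_ne_zero.2 h.symm)
  rw [reflTangent]
  set e := ‖q₁ - q₀‖⁻¹ • (q₁ - q₀)
  have hee : (inner ℝ e e : ℝ) = 1 := by rw [real_inner_self_eq_norm_sq, he]; norm_num
  have : ‖(2 * inner ℝ e t) • e - t - e‖ ^ 2 = ‖t - e‖ ^ 2 := by
    rw [← real_inner_self_eq_norm_sq, ← real_inner_self_eq_norm_sq]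
    simp only [inner_sub_left, inner_sub_right, real_inner_smul_left, real_inner_smul_right, hee,
      real_inner_comm e t]
    ring
  exact (sq_eq_sq₀ (norm_nonneg _) (norm_nonneg _)).1 this

/-- In an isosceles triangle with legs `d` and base `D` both legs make the same angle with the base,
so closeness of `u` to `e` passes to `u'`, and `D = 2 d ⟨u, e⟩ ≥ 2 d (1 - 2 δ²)`. Each tangent is
within `3 δ` of its leg, hence each arc satisfies `l (1 - 9/2 δ²) ≤ d`. Combining the two gives a
relative excess of second order in `δ`; `20` is generous. -/
lemma length_le_of_isosceles {e u u' t₀ t₁ : E3} {D d δ l₁ l₂ : ℝ} (he : ‖e‖ = 1) (hu1 : ‖u‖ = 1)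
    (hu'1 : ‖u'‖ = 1) (hD : 0 < D) (hd0 : 0 < d) (hsum : D • e = d • u + d • u')
    (hδ0 : 0 ≤ δ) (hδ : δ ≤ 1 / 10) (hue : ‖u - e‖ ≤ 2 * δ)
    (ht₀ : ‖t₀‖ = 1) (ht₁ : ‖t₁‖ = 1) (h₀ : ‖t₀ - e‖ ≤ δ) (h₁ : ‖t₁ - e‖ ≤ δ)
    (hl₁ : 0 ≤ l₁) (hl₂ : 0 ≤ l₂)
    (ha₁ : l₁ * (inner ℝ t₀ (d • u) : ℝ) ≤ d ^ 2) (ha₂ : l₂ * (inner ℝ t₁ (d • u') : ℝ) ≤ d ^ 2) :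
    l₁ + l₂ ≤ D * (1 + 20 * δ ^ 2) := by
  have huu : (inner ℝ u u : ℝ) = 1 := by rw [real_inner_self_eq_norm_sq, hu1]; norm_num
  have huu' : (inner ℝ u' u' : ℝ) = 1 := by rw [real_inner_self_eq_norm_sq, hu'1]; norm_num
  have hiu : D * (inner ℝ u e : ℝ) = d + d * inner ℝ u u' := by
    have := congrArg (fun z => (inner ℝ u z : ℝ)) hsum
    simp only [inner_add_right, real_inner_smul_right, huu] at this
    linarith
  have hiu' : D * (inner ℝ u' e : ℝ) = d + d * inner ℝ u u' := by
    have := congrArg (fun z => (inner ℝ u' z : ℝ)) hsum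
    simp only [inner_add_right, real_inner_smul_right, huu'] at this
    rw [real_inner_comm u' u]
    linarith
  have hie : D = d * (inner ℝ u e : ℝ) + d * inner ℝ u' e := by
    have := congrArg (fun z => (inner ℝ z e : ℝ)) hsum
    simp only [inner_add_left, real_inner_smul_left, real_inner_self_eq_norm_sq, he] at this
    linarith
  have hsame : (inner ℝ u' e : ℝ) = inner ℝ u e :=
    mul_left_cancel₀ hD.ne' (by rw [hiu, hiu'])
  have hu'e : ‖u' - e‖ ≤ 2 * δ := by
    refine le_trans (le_of_eq ?_) hue
    rw [← sq_eq_sq₀ (norm_nonneg _) (norm_nonneg _), norm_sub_sq_unit hu1 he,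
      norm_sub_sq_unit hu'1 he, hsame]
  have hcos : 1 - 2 * δ ^ 2 ≤ (inner ℝ u e : ℝ) := by
    have h6 := norm_sub_sq_unit hu1 he
    have h7 : ‖u - e‖ ^ 2 ≤ (2 * δ) ^ 2 := by gcongr
    linarith
  have hd' : d * (1 - 2 * δ ^ 2) ≤ D / 2 := by rw [hsame] at hie; nlinarith only [hie, hcos, hd0]
  have hclose : ∀ t z : E3, ‖t‖ = 1 → ‖z‖ = 1 → ‖t - e‖ ≤ δ → ‖z - e‖ ≤ 2 * δ →
      1 - 9 / 2 * δ ^ 2 ≤ (inner ℝ t z : ℝ) := by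
    intro t z ht hz h1 h2
    have h3 : ‖t - z‖ ≤ 3 * δ := by
      have : t - z = (t - e) - (z - e) := by abel
      rw [this]
      exact (norm_sub_le _ _).trans (by linarith)
    have h4 := norm_sub_sq_unit ht hz
    have h5 : ‖t - z‖ ^ 2 ≤ (3 * δ) ^ 2 := by gcongr
    linarith
  have hlen : ∀ (t z : E3) (l : ℝ), ‖t‖ = 1 → ‖z‖ = 1 → ‖t - e‖ ≤ δ → ‖z - e‖ ≤ 2 * δ → 0 ≤ l →
      l * (inner ℝ t (d • z) : ℝ) ≤ d ^ 2 → l * (1 - 9 / 2 * δ ^ 2) ≤ d := by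
    intro t z l ht hz h1 h2 hl h3
    have h4 := hclose t z ht hz h1 h2
    rw [real_inner_smul_right] at h3
    have h5 : l * (inner ℝ t z : ℝ) ≤ d := by
      have : d * (l * (inner ℝ t z : ℝ)) ≤ d * d := by linarith
      exact le_of_mul_le_mul_left this hd0
    exact (mul_le_mul_of_nonneg_left h4 hl).trans h5
  have f1 := hlen t₀ u l₁ ht₀ hu1 h₀ hue hl₁ ha₁
  have f2 := hlen t₁ u' l₂ ht₁ hu'1 h₁ hu'e hl₂ ha₂
  have hδ2 : δ ^ 2 ≤ 1 / 100 := by nlinarith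
  have hδ2' : 0 ≤ δ ^ 2 := sq_nonneg δ
  set x := δ ^ 2
  have f3 : (l₁ + l₂) * ((1 - 9 / 2 * x) * (1 - 2 * x)) ≤ D := by
    have : (l₁ + l₂) * (1 - 9 / 2 * x) * (1 - 2 * x) ≤ (2 * d) * (1 - 2 * x) :=
      mul_le_mul_of_nonneg_right (by linarith) (by linarith)
    linarith
  have f4 : 1 ≤ ((1 - 9 / 2 * x) * (1 - 2 * x)) * (1 + 20 * x) := by
    nlinarith [mul_nonneg hδ2' (by linarith : 0 ≤ 1 / 100 - x), pow_nonneg hδ2' 3]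
  calc l₁ + l₂ ≤ (l₁ + l₂) * (((1 - 9 / 2 * x) * (1 - 2 * x)) * (1 + 20 * x)) :=
        le_mul_of_one_le_right (by linarith) f4
    _ = ((l₁ + l₂) * ((1 - 9 / 2 * x) * (1 - 2 * x))) * (1 + 20 * x) := by ring
    _ ≤ D * (1 + 20 * x) := by gcongr

/-- Length estimate for a balanced biarc whose end tangents are close to the chord direction. -/
lemma biarc_length_le {q₀ t₀ q₁ t₁ m : E3} {δ l₁ l₂ : ℝ} (hq : q₀ ≠ q₁) (ht₀ : ‖t₀‖ = 1)
    (ht₁ : ‖t₁‖ = 1) (hδ : δ ≤ 1 / 10)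
    (h₀ : ‖t₀ - ‖q₁ - q₀‖⁻¹ • (q₁ - q₀)‖ ≤ δ) (h₁ : ‖t₁ - ‖q₁ - q₀‖⁻¹ • (q₁ - q₀)‖ ≤ δ)
    (hm : m ∈ sigmaPlusPlus q₀ t₀ q₁ t₁) (hbal : ‖m - q₀‖ = ‖q₁ - m‖)
    (hl₁ : 0 ≤ l₁) (hl₂ : 0 ≤ l₂)
    (ha₁ : l₁ * (inner ℝ t₀ (m - q₀) : ℝ) ≤ ‖m - q₀‖ ^ 2)
    (ha₂ : l₂ * (inner ℝ t₁ (q₁ - m) : ℝ) ≤ ‖q₁ - m‖ ^ 2) :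
    l₁ + l₂ ≤ ‖q₁ - q₀‖ * (1 + 20 * δ ^ 2) := by
  have hδ0 : 0 ≤ δ := (norm_nonneg _).trans h₀
  have hD : 0 < ‖q₁ - q₀‖ := norm_pos_iff.2 (sub_ne_zero.2 hq.symm)
  have hrefl := norm_reflTangent_sub hq t₁
  obtain ⟨hw, k, l, hwk, hl, hkl, hend, τ, hτ, hmτ⟩ := hm
  have he : ‖‖q₁ - q₀‖⁻¹ • (q₁ - q₀)‖ = 1 := by
    rw [norm_smul, norm_inv, norm_norm, inv_mul_cancel₀ hD.ne']
  have hDe : q₁ - q₀ = ‖q₁ - q₀‖ • (‖q₁ - q₀‖⁻¹ • (q₁ - q₀)) := by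
    rw [smul_smul, mul_inv_cancel₀ hD.ne', one_smul]
  set w := t₀ + reflTangent q₀ q₁ t₁ with hwdef
  set e := ‖q₁ - q₀‖⁻¹ • (q₁ - q₀)
  set D := ‖q₁ - q₀‖
  clear_value e D
  have hw' : 0 < ‖w‖ := norm_pos_iff.2 hw
  have hv1 : ‖‖w‖⁻¹ • w‖ = 1 := by
    rw [norm_smul, norm_inv, norm_norm, inv_mul_cancel₀ hw'.ne']
  have hvk : (inner ℝ (‖w‖⁻¹ • w) k : ℝ) = 0 := by rw [real_inner_smul_left, hwk, mul_zero]
  have hch := norm_mul_inner_le_inner_chord hv1 hvk q₀ hτ hkl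
  rw [← hmτ, hend] at hch
  obtain ⟨hch, hmne⟩ := hch
  have hw2 : ‖w - (2 : ℝ) • e‖ ≤ 2 * δ := by
    have : w - (2 : ℝ) • e = (t₀ - e) + (reflTangent q₀ q₁ t₁ - e) := by
      rw [hwdef, two_smul]; abel
    rw [this]
    refine (norm_add_le _ _).trans ?_
    rw [hrefl]; linarith
  -- Since `w` is within `2 δ` of `2 e`, halving it leaves an error `δ`; normalizing instead of
  -- halving costs another `δ`.
  have hve : ‖‖w‖⁻¹ • w - e‖ ≤ 2 * δ := by
    have e1 : ‖w‖⁻¹ • w - e = (‖w‖⁻¹ • w - (1 / 2 : ℝ) • w) + (1 / 2 : ℝ) • (w - (2 : ℝ) • e) := by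
      rw [smul_sub, smul_smul]; norm_num
    have e2 : ‖‖w‖⁻¹ • w - (1 / 2 : ℝ) • w‖ ≤ δ := by
      have : ‖w‖⁻¹ • w - (1 / 2 : ℝ) • w = (1 - ‖w‖ / 2) • (‖w‖⁻¹ • w) := by
        rw [sub_smul, one_smul, smul_smul]
        congr 2
        field_simp
      rw [this, norm_smul, hv1, mul_one, Real.norm_eq_abs]
      have h2 := abs_norm_sub_norm_le w ((2 : ℝ) • e)
      rw [norm_smul, he] at h2
      have h3 := h2.trans hw2
      rw [abs_le] at h3 ⊢
      norm_num at h3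
      constructor <;> linarith
    rw [e1]
    refine (norm_add_le _ _).trans ?_
    rw [norm_smul]
    norm_num
    linarith
  set d := ‖m - q₀‖ with hd
  have hd0 : 0 < d := norm_pos_iff.2 (sub_ne_zero.2 hmne)
  set u := d⁻¹ • (m - q₀) with hu
  have hu1 : ‖u‖ = 1 := by rw [hu, norm_smul, norm_inv, ← hd, Real.norm_eq_abs, abs_of_pos hd0,
    inv_mul_cancel₀ hd0.ne']
  have hmu : m - q₀ = d • u := by rw [hu, smul_smul, mul_inv_cancel₀ hd0.ne', one_smul]
  set u' := d⁻¹ • (q₁ - m) with hu'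
  have hu'1 : ‖u'‖ = 1 := by rw [hu', norm_smul, norm_inv, ← hbal, Real.norm_eq_abs, abs_of_pos hd0,
    inv_mul_cancel₀ hd0.ne']
  have hmu' : q₁ - m = d • u' := by rw [hu', smul_smul, mul_inv_cancel₀ hd0.ne', one_smul]
  have hsum : D • e = d • u + d • u' := by rw [← hDe, ← hmu, ← hmu']; abel
  -- The chord from `q₀` to the matching point deviates from `e` no more than the initial tangent of
  -- `Σ₊₊` does.
  have hue : ‖u - e‖ ≤ 2 * δ := by
    refine le_trans ?_ hve
    rw [hmu, hDe, real_inner_smul_right, real_inner_smul_right, real_inner_smul_left u e d] at hch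
    have h5 : (inner ℝ (‖w‖⁻¹ • w) e : ℝ) ≤ inner ℝ u e := by
      have hpos : 0 < d * D := by positivity
      refine le_of_mul_le_mul_left ?_ hpos
      linarith
    rw [← sq_le_sq₀ (norm_nonneg _) (norm_nonneg _), norm_sub_sq_unit hu1 he,
      norm_sub_sq_unit hv1 he]
    linarith
  rw [hmu] at ha₁
  rw [← hbal, hmu'] at ha₂
  exact length_le_of_isosceles he hu1 hu'1 hD hd0 hsum hδ0 hδ hue ht₀ ht₁ h₀ h₁ hl₁ hl₂ ha₁ ha₂


/-! ### Arc length and end tangents of circular arcs -/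

lemma norm_unitTangent {β : ℝ → E3} {τ : ℝ} (h : deriv β τ ≠ 0) : ‖unitTangent β τ‖ = 1 := by
  rw [unitTangent, norm_smul, norm_inv, norm_norm, inv_mul_cancel₀ (norm_ne_zero_iff.2 h)]

lemma continuous_norm_deriv {β : ℝ → E3} (hβ : ContDiff ℝ 1 β) :
    Continuous fun τ => ‖deriv β τ‖ := (hβ.continuous_deriv le_rfl).norm

lemma arcLen_nonneg (β : ℝ → E3) {a b : ℝ} (h : a ≤ b) : 0 ≤ arcLen β a b :=
  intervalIntegral.integral_nonneg h fun _ _ => norm_nonneg _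

lemma arcLen_add {β : ℝ → E3} (hβ : ContDiff ℝ 1 β) (a b c : ℝ) :
    arcLen β a b + arcLen β b c = arcLen β a c :=
  intervalIntegral.integral_add_adjacent_intervals
    ((continuous_norm_deriv hβ).intervalIntegrable _ _)
    ((continuous_norm_deriv hβ).intervalIntegrable _ _)

lemma norm_sub_le_arcLen {β : ℝ → E3} (hβ : ContDiff ℝ 1 β) {a b : ℝ} (h : a ≤ b) :
    ‖β b - β a‖ ≤ arcLen β a b := by
  have hd : ∀ x ∈ Set.uIcc a b, DifferentiableAt ℝ β x := fun x _ =>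
    (hβ.differentiable one_ne_zero) x
  rw [← intervalIntegral.integral_deriv_eq_sub hd
    ((hβ.continuous_deriv le_rfl).intervalIntegrable _ _)]
  exact intervalIntegral.norm_integral_le_integral_norm h

lemma IsCircularArcOn.length_mul_inner_le {β : ℝ → E3} {a b : ℝ} (hβ : ContDiff ℝ 1 β)
    (hreg : ∀ τ, deriv β τ ≠ 0) (hab : a < b) (h : IsCircularArcOn β a b) :
    arcLen β a b * (inner ℝ (unitTangent β a) (β b - β a) : ℝ) ≤ ‖β b - β a‖ ^ 2 ∧
    arcLen β a b * (inner ℝ (unitTangent β b) (β b - β a) : ℝ) ≤ ‖β b - β a‖ ^ 2 := by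
  obtain ⟨k, hk, hkl, hpt⟩ := h
  have hb := hpt b (Set.right_mem_Icc.2 hab.le)
  have hl : HasDerivAt (arcLen β a) ‖deriv β b‖ b :=
    (continuous_norm_deriv hβ).integral_hasStrictDerivAt a b |>.hasDerivAt
  -- The arc formula holds only on `[a, b]`, so it yields a one-sided derivative at `b`. Since `β`
  -- is differentiable there, this identifies its actual end tangent.
  have h1 : HasDerivWithinAt β (‖deriv β b‖ • circleTangent (unitTangent β a) k (arcLen β a b))
      (Set.Icc a b) b := by
    refine HasDerivWithinAt.congr_of_mem ?_ hpt (Set.right_mem_Icc.2 hab.le)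
    exact ((hasDerivAt_circlePoint (β a) (unitTangent β a) k _).scomp b hl).hasDerivWithinAt
  have h2 : HasDerivWithinAt β (deriv β b) (Set.Icc a b) b :=
    ((hβ.differentiable one_ne_zero) b).hasDerivAt.hasDerivWithinAt
  have h3 := (uniqueDiffOn_Icc hab b (Set.right_mem_Icc.2 hab.le)).eq_deriv _ h2 h1
  have h4 : unitTangent β b = circleTangent (unitTangent β a) k (arcLen β a b) := by
    rw [unitTangent]
    nth_rewrite 2 [h3]
    rw [smul_smul, inv_mul_cancel₀ (norm_ne_zero_iff.2 (hreg b)), one_smul]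
  have h5 := length_mul_inner_le_norm_sq (norm_unitTangent (hreg a)) hk (β a)
    (arcLen_nonneg β hab.le) hkl
  rwa [← hb, ← h4] at h5

/-! ### Estimates for `C^{1,1}` curves -/

/-- Mean value inequality for `x ↦ γ x - x • v`. -/
lemma norm_sub_sub_smul_le {γ : ℝ → E3} (hγ : Differentiable ℝ γ) {s t B : ℝ} {v : E3}
    (h : ∀ x ∈ Set.uIcc s t, ‖deriv γ x - v‖ ≤ B) : ‖γ t - γ s - (t - s) • v‖ ≤ B * |t - s| := by
  have hd : ∀ x ∈ Set.uIcc s t,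
      HasDerivWithinAt (fun x => γ x - x • v) (deriv γ x - v) (Set.uIcc s t) x := by
    intro x _
    have := (hγ x).hasDerivAt.sub ((hasDerivAt_id x).smul_const v)
    rw [one_smul] at this
    exact this.hasDerivWithinAt
  have := (convex_uIcc s t).norm_image_sub_le_of_norm_hasDerivWithin_le hd h
    Set.left_mem_uIcc Set.right_mem_uIcc
  rw [Real.norm_eq_abs] at this
  have e : γ t - γ s - (t - s) • v = γ t - t • v - (γ s - s • v) := by rw [sub_smul]; abel
  rwa [e]

lemma abs_sub_le_of_mem_uIcc {s t x : ℝ} (h : x ∈ Set.uIcc s t) :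
    |x - s| ≤ |t - s| ∧ |x - t| ≤ |t - s| :=
  ⟨Set.abs_sub_left_of_mem_uIcc h, by rw [abs_sub_comm x t]; exact Set.abs_sub_right_of_mem_uIcc h⟩

namespace IsC11ia

variable {L : ℝ} {γ : ℝ → E3}

lemma differentiable (hγ : IsC11ia L γ) : Differentiable ℝ γ :=
  hγ.contDiff.differentiable one_ne_zero

lemma exists_lipschitz (hγ : IsC11ia L γ) :
    ∃ K : ℝ, 1 ≤ K ∧ ∀ s t, ‖deriv γ s - deriv γ t‖ ≤ K * |s - t| := by
  obtain ⟨K, hK⟩ := hγ.lipschitz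
  refine ⟨K + 1, by simp, fun s t => ?_⟩
  have := hK.dist_le_mul s t
  rw [dist_eq_norm, Real.dist_eq] at this
  refine this.trans ?_
  gcongr
  linarith

lemma norm_sub_le (hγ : IsC11ia L γ) (s t : ℝ) : ‖γ s - γ t‖ ≤ |s - t| := by
  have := norm_sub_sub_smul_le hγ.differentiable (s := t) (t := s) (B := 1) (v := 0)
    (fun x _ => by rw [sub_zero, hγ.arclength])
  simpa using this

lemma taylor_le (hγ : IsC11ia L γ) {K : ℝ} (hK1 : 1 ≤ K)
    (hK : ∀ s t, ‖deriv γ s - deriv γ t‖ ≤ K * |s - t|) (s t : ℝ) :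
    ‖γ t - γ s - (t - s) • deriv γ s‖ ≤ K * |t - s| ^ 2 ∧
    ‖γ t - γ s - (t - s) • deriv γ t‖ ≤ K * |t - s| ^ 2 := by
  rw [pow_two, ← mul_assoc]
  constructor
  · refine norm_sub_sub_smul_le hγ.differentiable fun x hx => (hK x s).trans ?_
    exact mul_le_mul_of_nonneg_left (abs_sub_le_of_mem_uIcc hx).1 (by linarith)
  · refine norm_sub_sub_smul_le hγ.differentiable fun x hx => (hK x t).trans ?_
    exact mul_le_mul_of_nonneg_left (abs_sub_le_of_mem_uIcc hx).2 (by linarith)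

lemma le_norm_sub (hγ : IsC11ia L γ) {K : ℝ} (hK1 : 1 ≤ K)
    (hK : ∀ s t, ‖deriv γ s - deriv γ t‖ ≤ K * |s - t|) (s t : ℝ) :
    |t - s| - K * |t - s| ^ 2 ≤ ‖γ t - γ s‖ := by
  have h1 := (hγ.taylor_le hK1 hK s t).1
  have h2 : ‖(t - s) • deriv γ s‖ = |t - s| := by
    rw [norm_smul, hγ.arclength, mul_one, Real.norm_eq_abs]
  have h3 := norm_sub_norm_le ((t - s) • deriv γ s) (γ t - γ s)
  rw [norm_sub_rev _ (γ t - γ s)] at h3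
  linarith

/-- End tangents are close to the chord direction. -/
lemma norm_deriv_sub_chord_le (hγ : IsC11ia L γ) {K : ℝ} (hK1 : 1 ≤ K)
    (hK : ∀ s t, ‖deriv γ s - deriv γ t‖ ≤ K * |s - t|) {s t : ℝ} (hst : s < t)
    (hne : γ s ≠ γ t) :
    ‖deriv γ s - ‖γ t - γ s‖⁻¹ • (γ t - γ s)‖ ≤ 2 * K * (t - s) ∧
    ‖deriv γ t - ‖γ t - γ s‖⁻¹ • (γ t - γ s)‖ ≤ 2 * K * (t - s) := by
  have hh : 0 < t - s := sub_pos.2 hst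
  have hD : 0 < ‖γ t - γ s‖ := norm_pos_iff.2 (sub_ne_zero.2 hne.symm)
  have hT := hγ.taylor_le hK1 hK s t
  rw [abs_of_pos hh] at hT
  have key : ∀ v : E3, ‖v‖ = 1 → ‖γ t - γ s - (t - s) • v‖ ≤ K * (t - s) ^ 2 →
      ‖v - ‖γ t - γ s‖⁻¹ • (γ t - γ s)‖ ≤ 2 * K * (t - s) := by
    intro v hv h
    set D := ‖γ t - γ s‖
    have e1 : (t - s) • (v - D⁻¹ • (γ t - γ s))
        = -(γ t - γ s - (t - s) • v) + (D - (t - s)) • (D⁻¹ • (γ t - γ s)) := by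
      rw [sub_smul D, smul_smul D, mul_inv_cancel₀ hD.ne', one_smul, smul_sub]; abel
    have e2 : ‖D⁻¹ • (γ t - γ s)‖ = 1 := by
      rw [norm_smul, norm_inv, Real.norm_eq_abs, abs_of_pos hD, inv_mul_cancel₀ hD.ne']
    have e3 : |D - (t - s)| ≤ K * (t - s) ^ 2 := by
      have := abs_norm_sub_norm_le (γ t - γ s) ((t - s) • v)
      rw [norm_smul, hv, Real.norm_eq_abs, abs_of_pos hh, mul_one] at this
      exact this.trans h
    have e4 := norm_add_le (-(γ t - γ s - (t - s) • v)) ((D - (t - s)) • (D⁻¹ • (γ t - γ s)))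
    rw [← e1, norm_neg, norm_smul, norm_smul, e2, Real.norm_eq_abs, Real.norm_eq_abs,
      abs_of_pos hh, mul_one] at e4
    have : (t - s) * ‖v - D⁻¹ • (γ t - γ s)‖ ≤ (t - s) * (2 * K * (t - s)) := by
      linarith [e4, h, e3]
    exact le_of_mul_le_mul_left this hh
  exact ⟨key _ (hγ.arclength s) hT.1, key _ (hγ.arclength t) hT.2⟩

lemma deriv_add_period (hγ : IsC11ia L γ) (s : ℝ) : deriv γ (s + L) = deriv γ s := by
  have : (fun x => γ (x + L)) = γ := funext hγ.periodic
  rw [← deriv_comp_add_const, this]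

lemma deriv_periodic (hγ : IsC11ia L γ) : Function.Periodic (deriv γ) L := hγ.deriv_add_period

lemma ne_of_abs_sub_lt (hγ : IsC11ia L γ) (hL : 0 < L) {s t : ℝ} (hst : s ≠ t) (h : |s - t| < L) :
    γ s ≠ γ t := by
  intro heq
  have hs1 := toIcoMod_mem_Ico hL 0 s
  have ht1 := toIcoMod_mem_Ico hL 0 t
  rw [zero_add] at hs1 ht1
  have hs2 : γ (toIcoMod hL 0 s) = γ s := hγ.periodic.sub_zsmul_eq _
  have ht2 : γ (toIcoMod hL 0 t) = γ t := hγ.periodic.sub_zsmul_eq _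
  have h3 := hγ.injective hs1 ht1 (by rw [hs2, ht2, heq])
  simp only [toIcoMod, zsmul_eq_mul] at h3
  set m := toIcoDiv hL 0 s
  set k := toIcoDiv hL 0 t
  have h4 : s - t = ((m - k : ℤ) : ℝ) * L := by push_cast; linarith
  rw [h4, abs_mul, abs_of_pos hL] at h
  have h5 : |((m - k : ℤ) : ℝ)| < 1 := by
    by_contra hc
    push Not at hc
    nlinarith
  have h6 : m - k = 0 := by
    rw [← Int.cast_abs] at h5
    exact Int.abs_lt_one_iff.1 (by exact_mod_cast h5)
  rw [h6] at h4
  simp at h4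
  exact hst (by linarith)

/-- Bi-Lipschitz estimate. -/
lemma exists_mul_abs_sub_le (hγ : IsC11ia L γ) (hL : 0 < L) :
    ∃ c : ℝ, 0 < c ∧ ∀ s t, |s - t| ≤ L / 2 → c * |s - t| ≤ ‖γ s - γ t‖ := by
  obtain ⟨K, hK1, hK⟩ := hγ.exists_lipschitz
  have hcont := hγ.contDiff.continuous
  -- Increments below `1 / (2K)` are handled by Taylor with factor `1 / 2`. For the others, up to `L
  -- / 2`, injectivity and compactness give a positive minimum chord; the base point may be taken in
  -- one period.
  set S : Set (ℝ × ℝ) := {z | z.1 ∈ Set.Icc 0 L ∧ |z.2| ∈ Set.Icc (1 / (2 * K)) (L / 2)} with hS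
  have hSc : IsCompact S := by
    refine IsCompact.of_isClosed_subset (s := Set.Icc 0 L ×ˢ Set.Icc (-(L / 2)) (L / 2))
      (isCompact_Icc.prod isCompact_Icc) ?_ ?_
    · exact (isClosed_Icc.preimage continuous_fst).inter
        (isClosed_Icc.preimage (continuous_abs.comp continuous_snd))
    · rintro ⟨x, y⟩ ⟨h1, h2⟩
      exact ⟨h1, abs_le.1 h2.2⟩
  have hf : ContinuousOn (fun z : ℝ × ℝ => ‖γ z.1 - γ (z.1 + z.2)‖) S := by fun_prop
  obtain ⟨μ, hμ0, hμ⟩ := hSc.exists_forall_le' hf (a := 0) (by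
    rintro ⟨x, y⟩ ⟨_, h2⟩
    have hy : 0 < |y| := lt_of_lt_of_le (by positivity) h2.1
    refine norm_pos_iff.2 (sub_ne_zero.2 (hγ.ne_of_abs_sub_lt hL ?_ ?_))
    · simpa [eq_comm] using abs_pos.1 hy
    · have := h2.2
      simp only [sub_add_cancel_left, abs_neg] at this ⊢
      linarith)
  refine ⟨min (1 / 2) (μ * (2 / L)), by positivity, fun s t hst => ?_⟩
  rcases le_or_gt (|s - t|) (1 / (2 * K)) with h | h
  · have h1 := hγ.le_norm_sub hK1 hK t s
    have h2 : K * |s - t| ≤ 1 / 2 := by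
      rw [le_div_iff₀ (by positivity)] at h; linarith
    have h3 : K * |s - t| ^ 2 ≤ 1 / 2 * |s - t| := by
      rw [pow_two, ← mul_assoc]; gcongr
    have h4 : min (1 / 2) (μ * (2 / L)) * |s - t| ≤ 1 / 2 * |s - t| := by
      gcongr; exact min_le_left _ _
    linarith
  · have hs1 := toIcoMod_mem_Ico hL 0 s
    rw [zero_add] at hs1
    have hs2 : γ (toIcoMod hL 0 s) = γ s := hγ.periodic.sub_zsmul_eq _
    have ht2 : γ (toIcoMod hL 0 s + (t - s)) = γ t := by
      have : toIcoMod hL 0 s + (t - s) = t - toIcoDiv hL 0 s • L := by simp only [toIcoMod]; ring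
      rw [this]; exact hγ.periodic.sub_zsmul_eq _
    have h5 := hμ (toIcoMod hL 0 s, t - s) ⟨⟨hs1.1, hs1.2.le⟩, by
      rw [abs_sub_comm]; exact ⟨h.le, hst⟩⟩
    simp only [hs2, ht2] at h5
    refine le_trans ?_ h5
    calc min (1 / 2) (μ * (2 / L)) * |s - t| ≤ (μ * (2 / L)) * (L / 2) := by
          gcongr
          exact min_le_right _ _
      _ = μ := by field_simp

lemma exists_int_abs_le (hL : 0 < L) (x : ℝ) : ∃ m : ℤ, |x - m * L| ≤ L / 2 := by
  refine ⟨round (x / L), ?_⟩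
  have h := abs_sub_round (x / L)
  have : x - round (x / L) * L = (x / L - round (x / L)) * L := by field_simp
  rw [this, abs_mul, abs_of_pos hL]
  nlinarith

/-- In terms of the chord length, the derivative is globally Lipschitz and the deviation from the
tangent line is globally quadratic. -/
lemma exists_chord_bounds (hγ : IsC11ia L γ) (hL : 0 < L) :
    ∃ K : ℝ, 1 ≤ K ∧ (∀ s t, ‖deriv γ s - deriv γ t‖ ≤ K * |s - t|) ∧
      (∀ s t, ‖deriv γ s - deriv γ t‖ ≤ K * ‖γ s - γ t‖) ∧
      ∀ s t, ‖perp (deriv γ s) (γ t - γ s)‖ ≤ K * ‖γ s - γ t‖ ^ 2 := by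
  obtain ⟨K, hK1, hK⟩ := hγ.exists_lipschitz
  obtain ⟨c, hc, hcγ⟩ := hγ.exists_mul_abs_sub_le hL
  -- By periodicity `t` may be moved to within `L / 2` of `s`, where parameter distance is at most
  -- chord length over `c`.
  have hred : ∀ s t, ∃ t', |s - t'| ≤ L / 2 ∧ γ t' = γ t ∧ deriv γ t' = deriv γ t := by
    intro s t
    obtain ⟨m, hm⟩ := exists_int_abs_le hL (s - t)
    refine ⟨t + m * L, by rw [← sub_sub]; exact hm, ?_, ?_⟩
    · simpa using hγ.periodic.int_mul m t
    · simpa using hγ.deriv_periodic.int_mul m t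
  refine ⟨max K (max (K / c) (K / c ^ 2)), le_max_of_le_left hK1, fun s t => ?_, fun s t => ?_,
    fun s t => ?_⟩
  · refine (hK s t).trans ?_
    gcongr
    exact le_max_left _ _
  · obtain ⟨t', h1, h2, h3⟩ := hred s t
    rw [← h2, ← h3]
    have h4 := hcγ s t' h1
    calc ‖deriv γ s - deriv γ t'‖ ≤ K * |s - t'| := hK s t'
      _ = K / c * (c * |s - t'|) := by field_simp
      _ ≤ max K (max (K / c) (K / c ^ 2)) * ‖γ s - γ t'‖ := by
        gcongr
        exact le_max_of_le_right (le_max_left _ _)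
  · obtain ⟨t', h1, h2, h3⟩ := hred s t
    rw [← h2]
    have h4 := hcγ s t' h1
    have h5 := (hγ.taylor_le hK1 hK s t').1
    rw [abs_sub_comm] at h5
    calc ‖perp (deriv γ s) (γ t' - γ s)‖ ≤ K * |s - t'| ^ 2 :=
          (norm_perp_le_norm_sub_smul (hγ.arclength s) _ _).trans h5
      _ = K / c ^ 2 * (c * |s - t'|) ^ 2 := by field_simp
      _ ≤ max K (max (K / c) (K / c ^ 2)) * ‖γ s - γ t'‖ ^ 2 := by
        gcongr
        exact le_max_of_le_right (le_max_right _ _)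

end IsC11ia


/-! ### Regularity of the kernel away from the diagonal -/

lemma abs_rpow_sub_rpow_le {q M x y : ℝ} (hq : 1 ≤ q) (hx : x ∈ Set.Icc 0 M)
    (hy : y ∈ Set.Icc 0 M) : |x ^ q - y ^ q| ≤ q * M ^ (q - 1) * |x - y| := by
  have hd : ∀ z ∈ Set.Icc 0 M,
      HasDerivWithinAt (fun z : ℝ => z ^ q) (q * z ^ (q - 1)) (Set.Icc 0 M) z := fun z _ =>
    (Real.hasDerivAt_rpow_const (Or.inr hq)).hasDerivWithinAt
  refine (convex_Icc 0 M).norm_image_sub_le_of_norm_hasDerivWithin_le hd (fun z hz => ?_) hy hx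
  have hz1 : z ^ (q - 1) ≤ M ^ (q - 1) := Real.rpow_le_rpow hz.1 hz.2 (by linarith)
  have hz0 : 0 ≤ z ^ (q - 1) := Real.rpow_nonneg hz.1 _
  rw [Real.norm_eq_abs, abs_of_nonneg (by positivity)]
  gcongr

/-- The integrand of the tangent-point energy. -/
def tpKernel (q : ℝ) (γ : ℝ → E3) (s t : ℝ) : ℝ :=
  invTangentPointRadius (γ s) (deriv γ s) (γ t) ^ q

lemma tpKernel_nonneg (q : ℝ) (γ : ℝ → E3) (s t : ℝ) : 0 ≤ tpKernel q γ s t :=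
  Real.rpow_nonneg (invTangentPointRadius_nonneg _ _ _) _

/-- Perturbation of a quotient `A / ρ ^ 2` when the numerator is quadratically bounded. -/
lemma abs_div_sq_sub_div_sq_le {A A' ρ ρ' M η C : ℝ} (hρ : 0 < ρ) (hρ' : |ρ - ρ'| ≤ 2 * η)
    (hη : η ≤ ρ / 4) (hA' : |A'| ≤ M * ρ' ^ 2) (hA : |A - A'| ≤ C * η * ρ) :
    |A / ρ ^ 2 - A' / ρ' ^ 2| ≤ (C + 5 * M) * η / ρ := by
  have h1 := abs_le.1 hρ'
  have hρ'0 : 0 < ρ' := by linarith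
  have hη0 : 0 ≤ η := by linarith [abs_nonneg (ρ - ρ')]
  have hM : 0 ≤ M := by
    by_contra hc
    push Not at hc
    nlinarith [abs_nonneg A', pow_pos hρ'0 2]
  -- Change the numerator first, then the denominator. The second change is a bounded quotient times
  -- `(ρ' - ρ)(ρ' + ρ) / ρ²`, and `ρ' + ρ ≤ 5/2 ρ` produces the factor `5`.
  have e : A / ρ ^ 2 - A' / ρ' ^ 2
      = (A - A') / ρ ^ 2 + A' / ρ' ^ 2 * ((ρ' - ρ) * (ρ' + ρ)) / ρ ^ 2 := by
    field_simp; ring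
  have h2 : |(A - A') / ρ ^ 2| ≤ C * η / ρ := by
    rw [abs_div, abs_of_pos (pow_pos hρ 2), div_le_div_iff₀ (pow_pos hρ 2) hρ]
    calc |A - A'| * ρ ≤ C * η * ρ * ρ := by gcongr
      _ = _ := by ring
  have h3 : |A' / ρ' ^ 2| ≤ M := by
    rw [abs_div, abs_of_pos (pow_pos hρ'0 2), div_le_iff₀ (pow_pos hρ'0 2)]; exact hA'
  have h4 : |(ρ' - ρ) * (ρ' + ρ)| ≤ 2 * η * (5 / 2 * ρ) := by
    rw [abs_mul, abs_sub_comm, abs_of_pos (by linarith : 0 < ρ' + ρ)]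
    gcongr
    linarith
  have h5 : |A' / ρ' ^ 2 * ((ρ' - ρ) * (ρ' + ρ)) / ρ ^ 2| ≤ 5 * M * η / ρ := by
    rw [abs_div, abs_mul, abs_of_pos (pow_pos hρ 2), div_le_div_iff₀ (pow_pos hρ 2) hρ]
    calc |A' / ρ' ^ 2| * |(ρ' - ρ) * (ρ' + ρ)| * ρ ≤ M * (2 * η * (5 / 2 * ρ)) * ρ := by gcongr
      _ = _ := by ring
  rw [e]
  refine (abs_add_le _ _).trans ((add_le_add h2 h5).trans (le_of_eq ?_))
  ring

namespace IsC11ia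

variable {L : ℝ} {γ : ℝ → E3}

lemma invTangentPointRadius_le (hγ : IsC11ia L γ) {K : ℝ} (hK1 : 1 ≤ K)
    (hP : ∀ s t, ‖perp (deriv γ s) (γ t - γ s)‖ ≤ K * ‖γ s - γ t‖ ^ 2) (s t : ℝ) :
    invTangentPointRadius (γ s) (deriv γ s) (γ t) ≤ 2 * K := by
  rw [invTangentPointRadius_eq (hγ.arclength s)]
  refine div_le_of_le_mul₀ (by positivity) (by positivity) ?_
  linarith [hP s t]

/-- Move `t`, then `s`, then the projection. Each step gains a factor `ρ` besides `η`: the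
displacement of `γ t` runs nearly along `γ' t`, which is itself within `K ρ` of `γ' s`; that of `γ
s` is tangential up to `K η²` with `η ≤ ρ / 4`; and the turned projection acts on a vector of length
at most `3/2 ρ`. The constants add up to `5/4 + 1/4 + 3 ≤ 5`. -/
lemma abs_norm_perp_sub_le (hγ : IsC11ia L γ) {K : ℝ} (hK1 : 1 ≤ K)
    (hK : ∀ s t, ‖deriv γ s - deriv γ t‖ ≤ K * |s - t|)
    (hρ : ∀ s t, ‖deriv γ s - deriv γ t‖ ≤ K * ‖γ s - γ t‖)
    {s t s' t' η : ℝ} (hs : |s' - s| ≤ η) (ht : |t' - t| ≤ η) (hη : η ≤ ‖γ s - γ t‖ / 4) :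
    |‖perp (deriv γ s) (γ t - γ s)‖ - ‖perp (deriv γ s') (γ t' - γ s')‖| ≤
      5 * K * η * ‖γ s - γ t‖ := by
  have hη0 : 0 ≤ η := (abs_nonneg _).trans hs
  set ρ := ‖γ s - γ t‖
  have e : perp (deriv γ s) (γ t - γ s) - perp (deriv γ s') (γ t' - γ s')
      = -perp (deriv γ s) (γ t' - γ t) + perp (deriv γ s) (γ s' - γ s)
        + (perp (deriv γ s) (γ t' - γ s') - perp (deriv γ s') (γ t' - γ s')) := by
    simp only [perp_sub]; abel
  have h1 : ‖perp (deriv γ s) (γ t' - γ t)‖ ≤ K * (5 / 4 * ρ) * η := by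
    refine (norm_perp_le_norm_sub_smul (hγ.arclength s) _ (t' - t)).trans ?_
    refine (norm_sub_sub_smul_le hγ.differentiable (B := K * (5 / 4 * ρ)) fun x hx => ?_).trans ?_
    · have h2 : ‖deriv γ x - deriv γ t‖ ≤ K * η :=
        (hK x t).trans (mul_le_mul_of_nonneg_left
          ((abs_sub_le_of_mem_uIcc hx).1.trans ht) (by linarith))
      have h3 := hρ t s
      rw [norm_sub_rev (γ t)] at h3
      have h4 := norm_sub_le_norm_sub_add_norm_sub (deriv γ x) (deriv γ t) (deriv γ s)
      have h5 : K * η ≤ K * (ρ / 4) := by gcongr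
      linarith
    · gcongr
  have h2 : ‖perp (deriv γ s) (γ s' - γ s)‖ ≤ K * η * (ρ / 4) := by
    refine (norm_perp_le_norm_sub_smul (hγ.arclength s) _ (s' - s)).trans ?_
    refine (hγ.taylor_le hK1 hK s s').1.trans ?_
    calc K * |s' - s| ^ 2 ≤ K * η ^ 2 := by gcongr
      _ = K * η * η := by ring
      _ ≤ K * η * (ρ / 4) := by gcongr
  have h3 : ‖perp (deriv γ s) (γ t' - γ s') - perp (deriv γ s') (γ t' - γ s')‖
      ≤ 2 * (K * η) * (3 / 2 * ρ) := by
    refine (norm_perp_sub_perp_le (hγ.arclength s) (hγ.arclength s') _).trans ?_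
    have h4 : ‖deriv γ s - deriv γ s'‖ ≤ K * η := by
      refine (hK s s').trans ?_
      rw [abs_sub_comm]; gcongr
    have h5 : ‖γ t' - γ s'‖ ≤ 3 / 2 * ρ := by
      have h6 := (hγ.norm_sub_le t' t).trans ht
      have h7 := (hγ.norm_sub_le s' s).trans hs
      have e2 : γ t' - γ s' = (γ t' - γ t) - (γ s' - γ s) - (γ s - γ t) := by abel
      have h8 := _root_.norm_sub_le ((γ t' - γ t) - (γ s' - γ s)) (γ s - γ t)
      have h9 := _root_.norm_sub_le (γ t' - γ t) (γ s' - γ s)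
      rw [← e2] at h8
      linarith
    gcongr
  refine (abs_norm_sub_norm_le _ _).trans ?_
  rw [e]
  refine (norm_add_le _ _).trans ((add_le_add_left (norm_add_le _ _) _).trans ?_)
  rw [norm_neg]
  have hpos : 0 ≤ K * η * ρ := by positivity
  linarith

/-- For `η ≤ ρ / 4` the quotient estimate gives `10 K + 5 · 2 K = 20 K`. For larger `η` the
right-hand side exceeds `5 K`, so boundedness by `2 K` suffices. -/
lemma exists_abs_invTangentPointRadius_sub_le (hγ : IsC11ia L γ) (hL : 0 < L) :
    ∃ M C : ℝ, 0 < M ∧ 0 < C ∧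
      (∀ s t, invTangentPointRadius (γ s) (deriv γ s) (γ t) ≤ M) ∧
      ∀ s t s' t' η : ℝ, |s' - s| ≤ η → |t' - t| ≤ η → γ s ≠ γ t →
        |invTangentPointRadius (γ s) (deriv γ s) (γ t) -
          invTangentPointRadius (γ s') (deriv γ s') (γ t')| ≤ C * η / ‖γ s - γ t‖ := by
  obtain ⟨K, hK1, hK, hρ, hP⟩ := hγ.exists_chord_bounds hL
  have hM := hγ.invTangentPointRadius_le hK1 hP
  refine ⟨2 * K, 20 * K, by positivity, by positivity, hM, fun s t s' t' η hs ht hne => ?_⟩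
  have hρ0 : 0 < ‖γ s - γ t‖ := norm_pos_iff.2 (sub_ne_zero.2 hne)
  rcases le_or_gt η (‖γ s - γ t‖ / 4) with h | h
  · rw [invTangentPointRadius_eq (hγ.arclength s), invTangentPointRadius_eq (hγ.arclength s')]
    have h1 := hγ.abs_norm_perp_sub_le hK1 hK hρ hs ht h
    have h2 : |‖γ s - γ t‖ - ‖γ s' - γ t'‖| ≤ 2 * η := by
      refine (abs_norm_sub_norm_le _ _).trans ?_
      have e2 : γ s - γ t - (γ s' - γ t') = (γ t' - γ t) - (γ s' - γ s) := by abel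
      rw [e2]
      refine (_root_.norm_sub_le _ _).trans ?_
      linarith [(hγ.norm_sub_le t' t).trans ht, (hγ.norm_sub_le s' s).trans hs]
    refine (abs_div_sq_sub_div_sq_le (M := 2 * K) (C := 10 * K) hρ0 h2 h ?_ ?_).trans
      (le_of_eq ?_)
    · rw [abs_of_nonneg (by positivity)]
      linarith [hP s' t']
    · rw [← mul_sub, abs_mul, abs_two]
      linarith
    · ring
  · have h0 := invTangentPointRadius_nonneg (γ s) (deriv γ s) (γ t)
    have h0' := invTangentPointRadius_nonneg (γ s') (deriv γ s') (γ t')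
    have h1 : |invTangentPointRadius (γ s) (deriv γ s) (γ t) -
          invTangentPointRadius (γ s') (deriv γ s') (γ t')| ≤ 2 * K :=
      abs_le.2 ⟨by linarith [hM s' t'], by linarith [hM s t]⟩
    refine h1.trans ?_
    rw [le_div_iff₀ hρ0]
    nlinarith

lemma exists_tpKernel_bounds (hγ : IsC11ia L γ) (hL : 0 < L) {q : ℝ} (hq : 1 ≤ q) :
    ∃ M C : ℝ, 0 < M ∧ 0 < C ∧ (∀ s t, tpKernel q γ s t ≤ M) ∧
      ∀ s t s' t' η : ℝ, |s' - s| ≤ η → |t' - t| ≤ η → γ s ≠ γ t →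
        |tpKernel q γ s t - tpKernel q γ s' t'| ≤ C * η / ‖γ s - γ t‖ := by
  obtain ⟨M, C, hM, hC, h1, h2⟩ := hγ.exists_abs_invTangentPointRadius_sub_le hL
  have hmem : ∀ s t, invTangentPointRadius (γ s) (deriv γ s) (γ t) ∈ Set.Icc 0 M := fun s t =>
    ⟨invTangentPointRadius_nonneg _ _ _, h1 s t⟩
  refine ⟨M ^ q, q * M ^ (q - 1) * C, by positivity, by positivity,
    fun s t => Real.rpow_le_rpow (hmem s t).1 (h1 s t) (by linarith),
    fun s t s' t' η hs ht hne => ?_⟩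
  refine (abs_rpow_sub_rpow_le hq (hmem s t) (hmem s' t')).trans ?_
  calc q * M ^ (q - 1) * _ ≤ q * M ^ (q - 1) * (C * η / ‖γ s - γ t‖) := by
        gcongr
        exact h2 s t s' t' η hs ht hne
    _ = _ := by ring

lemma measurable_tpKernel (hγ : IsC11ia L γ) (q : ℝ) :
    Measurable (Function.uncurry (tpKernel q γ)) := by
  have e : Function.uncurry (tpKernel q γ) = fun z : ℝ × ℝ =>
      (2 * ‖perp (deriv γ z.1) (γ z.2 - γ z.1)‖ / ‖γ z.1 - γ z.2‖ ^ 2) ^ q := by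
    ext ⟨s, t⟩
    simp only [Function.uncurry, tpKernel, invTangentPointRadius_eq (hγ.arclength s)]
  rw [e]
  have h1 : Continuous γ := hγ.contDiff.continuous
  have h2 : Continuous (deriv γ) := hγ.contDiff.continuous_deriv le_rfl
  have h3 : Measurable fun z : ℝ × ℝ => ‖perp (deriv γ z.1) (γ z.2 - γ z.1)‖ := by
    apply Continuous.measurable
    unfold perp
    fun_prop
  have h4 : Measurable fun z : ℝ × ℝ => ‖γ z.1 - γ z.2‖ := by
    apply Continuous.measurable
    fun_prop
  exact ((h3.const_mul 2).div (h4.pow_const 2)).pow_const q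

/-- Here `r` is below the length of both parameter arcs between the points. If `t - s` exceeds half
a period, the shorter arc runs from `t` to `s + L`. -/
lemma exists_mul_min_le (hγ : IsC11ia L γ) (hL : 0 < L) :
    ∃ c : ℝ, 0 < c ∧ ∀ s t r, s ≤ t → r ≤ t - s → r ≤ L - (t - s) → c * r ≤ ‖γ s - γ t‖ := by
  obtain ⟨c, hc, h⟩ := hγ.exists_mul_abs_sub_le hL
  refine ⟨c, hc, fun s t r hst h1 h2 => ?_⟩
  rcases le_or_gt (t - s) (L / 2) with h3 | h3
  · have h4 := h s t (by rw [abs_sub_comm, abs_of_nonneg (by linarith)]; exact h3)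
    rw [abs_sub_comm, abs_of_nonneg (by linarith)] at h4
    exact (mul_le_mul_of_nonneg_left h1 hc.le).trans h4
  · rcases le_or_gt r 0 with hr | hr
    · exact (mul_nonpos_of_nonneg_of_nonpos hc.le hr).trans (norm_nonneg _)
    · have e : |s + L - t| = L - (t - s) := by rw [abs_of_nonneg (by linarith)]; ring
      have h4 := h (s + L) t (by rw [e]; linarith)
      rw [e, hγ.periodic] at h4
      exact (mul_le_mul_of_nonneg_left h2 hc.le).trans h4

end IsC11ia

/-! ### Biarc length against parameter length -/

/-- The lengths of proper balanced biarcs agree with the parameter length up to second order. -/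
lemma IsC11ia.exists_abs_biarcLen_sub_le {L : ℝ} {γ : ℝ → E3} (hγ : IsC11ia L γ) :
    ∃ C h₀ : ℝ, 0 < C ∧ 0 < h₀ ∧ ∀ (n : ℕ) (β : MarkedCurve) (i : ℕ) (a b : ℝ),
      β ∈ MarkedCurve.biarcCurves n → i < n → a < b → b - a ≤ h₀ → β.InterpolatesAt γ i a b →
      β.MatchingInSigma i → ‖β.matching i - β.pt i‖ = ‖β.pt (i + 1) - β.matching i‖ →
      |β.biarcLen i - (b - a)| ≤ C * (b - a) ^ 2 := by
  obtain ⟨K, hK1, hK⟩ := hγ.exists_lipschitz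
  -- The threshold makes `δ = 2 K (b - a)` at most `1 / 10`, as `biarc_length_le` requires.
  refine ⟨8 * K, 1 / (20 * K), by positivity, by positivity,
    fun n β i a b hβ hi hab hh hint hsig hbal => ?_⟩
  obtain ⟨-, -, hdiff, hreg, hbi⟩ := hβ
  obtain ⟨hac, hcb, hne, harc₁, harc₂⟩ := hbi i hi
  obtain ⟨hp₀, ht₀, hp₁, ht₁⟩ := hint
  have ha₁ := (harc₁.length_mul_inner_le hdiff hreg hac).1
  have ha₂ := (harc₂.length_mul_inner_le hdiff hreg hcb).2
  have hchord := norm_sub_le_arcLen hdiff (hac.trans hcb).le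
  have hadd := arcLen_add hdiff (β.node i) (β.mid i) (β.node (i + 1))
  have hl₁ := arcLen_nonneg β.toFun hac.le
  have hl₂ := arcLen_nonneg β.toFun hcb.le
  rw [MarkedCurve.MatchingInSigma] at hsig
  rw [MarkedCurve.biarcLen]
  simp only [MarkedCurve.pt, MarkedCurve.tan, MarkedCurve.matching] at *
  set lam := arcLen β.toFun (β.node i) (β.node (i + 1))
  rw [hp₀, hp₁] at hne hchord hsig
  rw [ht₀, ht₁] at hsig
  rw [ht₀, hp₀] at ha₁
  rw [ht₁, hp₁] at ha₂
  rw [hp₀, hp₁] at hbal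
  have hpos : 0 < b - a := sub_pos.2 hab
  have hKh : K * (b - a) ≤ 1 / 20 := by
    rw [le_div_iff₀ (by positivity)] at hh; linarith
  obtain ⟨hc₀, hc₁⟩ := hγ.norm_deriv_sub_chord_le hK1 hK hab hne
  have hup := biarc_length_le hne (hγ.arclength a) (hγ.arclength b) (by linarith) hc₀ hc₁ hsig hbal
    hl₁ hl₂ ha₁ ha₂
  rw [hadd] at hup
  have hD1 := hγ.norm_sub_le b a
  have hD2 := hγ.le_norm_sub hK1 hK a b
  rw [abs_of_pos hpos] at hD1 hD2
  have hfin : lam ≤ (b - a) * (1 + 20 * (2 * K * (b - a)) ^ 2) := hup.trans (by gcongr)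
  have h1 : 20 * (2 * K * (b - a)) ^ 2 ≤ 8 * K * (b - a) := by
    have h0 : 0 ≤ K * (b - a) := by positivity
    nlinarith
  have h2 : 0 ≤ K * (b - a) ^ 2 := by positivity
  rw [abs_le]
  constructor
  · linarith
  · nlinarith


/-! ### Riemann sums -/

lemma intervalIntegrable_section {G : ℝ → ℝ → ℝ} {M : ℝ} (hG : Measurable (Function.uncurry G))
    (hG0 : ∀ s t, 0 ≤ G s t) (hGM : ∀ s t, G s t ≤ M) (s c d : ℝ) :
    IntervalIntegrable (G s) volume c d := by
  refine (intervalIntegrable_const (c := M)).mono_fun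
    (hG.comp measurable_prodMk_left).aestronglyMeasurable (Filter.Eventually.of_forall fun t => ?_)
  refine le_trans ?_ (le_abs_self M)
  change |G s t| ≤ M
  rw [abs_of_nonneg (hG0 s t)]
  exact hGM s t

lemma intervalIntegrable_integral {G : ℝ → ℝ → ℝ} {M : ℝ} (hG : Measurable (Function.uncurry G))
    (hG0 : ∀ s t, 0 ≤ G s t) (hGM : ∀ s t, G s t ≤ M) (a b : ℝ) {c d : ℝ} (hcd : c ≤ d) :
    IntervalIntegrable (fun s => ∫ t in c..d, G s t) volume a b := by
  have hmeas : StronglyMeasurable fun s => ∫ t in c..d, G s t := by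
    simp only [intervalIntegral.integral_of_le hcd]
    exact hG.stronglyMeasurable.integral_prod_right
  refine (intervalIntegrable_const (c := M * |d - c|)).mono_fun hmeas.aestronglyMeasurable
    (Filter.Eventually.of_forall fun s => ?_)
  refine le_trans ?_ (le_abs_self _)
  refine intervalIntegral.norm_integral_le_of_norm_le_const fun t _ => ?_
  rw [Real.norm_eq_abs, abs_of_nonneg (hG0 s t)]
  exact hGM s t

lemma abs_integral_cell_sub_le {G : ℝ → ℝ → ℝ} {M : ℝ} (hG : Measurable (Function.uncurry G))
    (hG0 : ∀ s t, 0 ≤ G s t) (hGM : ∀ s t, G s t ≤ M) {a b c d v B : ℝ} (hab : a ≤ b) (hcd : c ≤ d)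
    (h : ∀ s ∈ Set.Icc a b, ∀ t ∈ Set.Icc c d, |G s t - v| ≤ B) :
    |(∫ s in a..b, ∫ t in c..d, G s t) - v * ((d - c) * (b - a))| ≤ B * ((d - c) * (b - a)) := by
  have hinner : ∀ s ∈ Set.Icc a b, |(∫ t in c..d, G s t) - v * (d - c)| ≤ B * (d - c) := by
    intro s hs
    have e : (∫ t in c..d, G s t) - v * (d - c) = ∫ t in c..d, (G s t - v) := by
      rw [intervalIntegral.integral_sub (intervalIntegrable_section hG hG0 hGM s c d) intervalIntegrable_const,
        intervalIntegral.integral_const, smul_eq_mul, mul_comm]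
    rw [e]
    have := intervalIntegral.norm_integral_le_of_norm_le_const (a := c) (b := d)
      (f := fun t => G s t - v) (C := B) (fun t ht => by
        rw [Set.uIoc_of_le hcd] at ht
        exact h s hs t ⟨ht.1.le, ht.2⟩)
    rwa [abs_of_nonneg (sub_nonneg.2 hcd)] at this
  have e : (∫ s in a..b, ∫ t in c..d, G s t) - v * ((d - c) * (b - a))
      = ∫ s in a..b, ((∫ t in c..d, G s t) - v * (d - c)) := by
    rw [intervalIntegral.integral_sub (intervalIntegrable_integral hG hG0 hGM a b hcd) intervalIntegrable_const,
      intervalIntegral.integral_const, smul_eq_mul]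
    ring
  rw [e]
  have := intervalIntegral.norm_integral_le_of_norm_le_const (a := a) (b := b)
      (f := fun s => (∫ t in c..d, G s t) - v * (d - c)) (C := B * (d - c)) (fun s hs => by
        rw [Set.uIoc_of_le hab] at hs
        exact hinner s ⟨hs.1.le, hs.2⟩)
  rwa [abs_of_nonneg (sub_nonneg.2 hab), Real.norm_eq_abs, mul_assoc] at this

lemma integral_integral_eq_sum_cells {G : ℝ → ℝ → ℝ} {M : ℝ} (hG : Measurable (Function.uncurry G))
    (hG0 : ∀ s t, 0 ≤ G s t) (hGM : ∀ s t, G s t ≤ M) {x : ℕ → ℝ} {n : ℕ}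
    (hx : ∀ k < n, x k ≤ x (k + 1)) :
    (∫ s in x 0..x n, ∫ t in x 0..x n, G s t) = ∑ i ∈ Finset.range n, ∑ j ∈ Finset.range n,
      ∫ s in x j..x (j + 1), ∫ t in x i..x (i + 1), G s t := by
  have e1 : ∀ s, (∫ t in x 0..x n, G s t) = ∑ i ∈ Finset.range n, ∫ t in x i..x (i + 1), G s t :=
    fun s => (intervalIntegral.sum_integral_adjacent_intervals fun k _ =>
      intervalIntegrable_section hG hG0 hGM s _ _).symm
  simp only [e1]
  rw [intervalIntegral.integral_finsetSum fun i hi =>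
    intervalIntegrable_integral hG hG0 hGM _ _ (hx i (Finset.mem_range.1 hi))]
  refine Finset.sum_congr rfl fun i hi => ?_
  exact (intervalIntegral.sum_integral_adjacent_intervals fun k _ =>
    intervalIntegrable_integral hG hG0 hGM _ _ (hx i (Finset.mem_range.1 hi))).symm

lemma abs_integral_sub_offDiagonal_sum_le {G : ℝ → ℝ → ℝ} {M : ℝ}
    (hG : Measurable (Function.uncurry G)) (hG0 : ∀ s t, 0 ≤ G s t) (hGM : ∀ s t, G s t ≤ M)
    {x : ℕ → ℝ} {n : ℕ} (hx : ∀ k < n, x k ≤ x (k + 1)) {B : ℕ → ℕ → ℝ}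
    (hB : ∀ i < n, ∀ j < n, j ≠ i → ∀ s ∈ Set.Icc (x j) (x (j + 1)),
      ∀ t ∈ Set.Icc (x i) (x (i + 1)), |G s t - G (x j) (x i)| ≤ B i j) :
    |(∫ s in x 0..x n, ∫ t in x 0..x n, G s t) -
      ∑ i ∈ Finset.range n, ∑ j ∈ (Finset.range n).erase i,
        G (x j) (x i) * ((x (i + 1) - x i) * (x (j + 1) - x j))| ≤
      ∑ i ∈ Finset.range n, (M * (x (i + 1) - x i) ^ 2 + ∑ j ∈ (Finset.range n).erase i,
        B i j * ((x (i + 1) - x i) * (x (j + 1) - x j))) := by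
  rw [integral_integral_eq_sum_cells hG hG0 hGM hx, ← Finset.sum_sub_distrib]
  refine (Finset.abs_sum_le_sum_abs _ _).trans (Finset.sum_le_sum fun i hi => ?_)
  have hi' := Finset.mem_range.1 hi
  rw [← Finset.add_sum_erase _ _ hi, add_sub_assoc, ← Finset.sum_sub_distrib]
  refine (abs_add_le _ _).trans (add_le_add ?_ ?_)
  · have := abs_integral_cell_sub_le hG hG0 hGM (hx i hi') (hx i hi') (v := 0) (B := M)
      (fun s _ t _ => by rw [sub_zero, abs_of_nonneg (hG0 s t)]; exact hGM s t)
    rwa [zero_mul, sub_zero, ← pow_two] at this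
  · refine (Finset.abs_sum_le_sum_abs _ _).trans (Finset.sum_le_sum fun j hj => ?_)
    obtain ⟨hji, hj⟩ := Finset.mem_erase.1 hj
    have hj' := Finset.mem_range.1 hj
    exact abs_integral_cell_sub_le hG hG0 hGM (hx j hj') (hx i hi') (hB i hi' j hj' hji)

/-- A bounded measurable kernel is integrable on the period square; finiteness of the energy comes
from here. -/
lemma tangentPointEnergy_eq_ofReal {q L M : ℝ} {γ : ℝ → E3} (hL : 0 < L) (hγ : IsC11ia L γ)
    (hM : ∀ s t, tpKernel q γ s t ≤ M) :
    tangentPointEnergy q L γ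
      = ENNReal.ofReal (∫ s in (0 : ℝ)..L, ∫ t in (0 : ℝ)..L, tpKernel q γ s t) := by
  have hmeas := hγ.measurable_tpKernel q
  simp only [intervalIntegral.integral_of_le hL.le]
  have hbd : ∀ s t, ‖tpKernel q γ s t‖ ≤ M := fun s t => by
    rw [Real.norm_eq_abs, abs_of_nonneg (tpKernel_nonneg q γ s t)]; exact hM s t
  have hin : ∀ s, Integrable (tpKernel q γ s) (volume.restrict (Set.Ioc 0 L)) := fun s =>
    Integrable.of_bound (hmeas.comp measurable_prodMk_left).aestronglyMeasurable M
      (Filter.Eventually.of_forall (hbd s))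
  have hmeas2 : StronglyMeasurable fun s => ∫ t in Set.Ioc 0 L, tpKernel q γ s t :=
    hmeas.stronglyMeasurable.integral_prod_right
  have hout : Integrable (fun s => ∫ t in Set.Ioc 0 L, tpKernel q γ s t)
      (volume.restrict (Set.Ioc 0 L)) := by
    refine Integrable.of_bound hmeas2.aestronglyMeasurable
      (M * (volume.restrict (Set.Ioc 0 L)).real Set.univ) (Filter.Eventually.of_forall fun s => ?_)
    exact norm_integral_le_of_norm_le_const (Filter.Eventually.of_forall (hbd s))
  rw [ofReal_integral_eq_lintegral_ofReal hout (Filter.Eventually.of_forall fun s =>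
    integral_nonneg fun t => tpKernel_nonneg q γ s t), tangentPointEnergy]
  refine lintegral_congr fun s => ?_
  rw [ofReal_integral_eq_lintegral_ofReal (hin s) (Filter.Eventually.of_forall fun t =>
    tpKernel_nonneg q γ s t)]
  rfl

/-! ### Cyclic harmonic sums -/

/-- An upper bound for the reciprocal of the cyclic distance of two indices at distance `k`. -/
def cyclicRecip (n k : ℕ) : ℝ := (k : ℝ)⁻¹ + ((n - k : ℕ) : ℝ)⁻¹

lemma cyclicRecip_nonneg (n k : ℕ) : 0 ≤ cyclicRecip n k := by
  unfold cyclicRecip; positivity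

lemma sum_inv_Ico_le (n : ℕ) : ∑ k ∈ Finset.Ico 1 n, (k : ℝ)⁻¹ ≤ 1 + Real.log n := by
  have h := harmonic_le_one_add_log n
  rw [harmonic_eq_sum_Icc] at h
  push_cast at h
  refine le_trans (Finset.sum_le_sum_of_subset_of_nonneg ?_ fun k _ _ => by positivity) h
  intro k hk
  simp only [Finset.mem_Ico, Finset.mem_Icc] at hk ⊢
  omega

lemma sum_cyclicRecip_Ico_le (n : ℕ) :
    ∑ k ∈ Finset.Ico 1 n, cyclicRecip n k ≤ 2 * (1 + Real.log n) := by
  have h : ∑ k ∈ Finset.Ico 1 n, ((n - k : ℕ) : ℝ)⁻¹ = ∑ k ∈ Finset.Ico 1 n, (k : ℝ)⁻¹ := by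
    refine Finset.sum_nbij' (fun k => n - k) (fun k => n - k) ?_ ?_ ?_ ?_ ?_ <;>
      intro k hk <;> simp only [Finset.mem_Ico] at hk ⊢ <;> omega
  simp only [cyclicRecip, Finset.sum_add_distrib, h]
  linarith [sum_inv_Ico_le n]

/-- On each side of `i` the distances are distinct numbers in `[1, n)`, so each side is dominated by
the full sum over that range. -/
lemma sum_cyclicRecip_dist_le {n i : ℕ} (hi : i < n) :
    ∑ j ∈ (Finset.range n).erase i, cyclicRecip n (Nat.dist i j) ≤ 4 * (1 + Real.log n) := by
  have hpart : ∀ S : Finset ℕ, (∀ j ∈ S, Nat.dist i j ∈ Finset.Ico 1 n) →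
      Set.InjOn (Nat.dist i) S →
      ∑ j ∈ S, cyclicRecip n (Nat.dist i j) ≤ 2 * (1 + Real.log n) := by
    intro S hS hinj
    rw [← Finset.sum_image (f := cyclicRecip n) hinj]
    refine le_trans (Finset.sum_le_sum_of_subset_of_nonneg (Finset.image_subset_iff.2 hS)
      fun k _ _ => cyclicRecip_nonneg n k) (sum_cyclicRecip_Ico_le n)
  rw [← Finset.sum_filter_add_sum_filter_not _ (fun j => j < i)]
  have h1 := hpart (((Finset.range n).erase i).filter fun j => j < i)
    (by
      intro j hj
      simp only [Finset.mem_filter, Finset.mem_erase, Finset.mem_range, Finset.mem_Ico, Nat.dist]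
        at hj ⊢
      omega)
    (by
      intro j hj k hk hjk
      simp only [Finset.coe_filter, Set.mem_ofPred_eq, Finset.mem_erase, Finset.mem_range, Nat.dist]
        at hj hk hjk
      omega)
  have h2 := hpart (((Finset.range n).erase i).filter fun j => ¬ j < i)
    (by
      intro j hj
      simp only [Finset.mem_filter, Finset.mem_erase, Finset.mem_range, Finset.mem_Ico, Nat.dist]
        at hj ⊢
      omega)
    (by
      intro j hj k hk hjk
      simp only [Finset.coe_filter, Set.mem_ofPred_eq, Finset.mem_erase, Finset.mem_range, Nat.dist]
        at hj hk hjk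
      omega)
  linarith

/-! ### Distributed partitions -/

lemma mul_sub_le_sub_of_step {x : ℕ → ℝ} {n : ℕ} {d : ℝ} (hx : ∀ k < n, d ≤ x (k + 1) - x k)
    {i j : ℕ} (hij : i ≤ j) (hj : j ≤ n) : d * ((j - i : ℕ) : ℝ) ≤ x j - x i := by
  induction j, hij using Nat.le_induction with
  | base => simp
  | succ j hij ih =>
    have h1 := ih (by omega)
    have h2 := hx j (by omega)
    rw [Nat.succ_sub hij]
    push_cast
    linarith

/-- At index distance `k` one parameter arc contains `k` steps and the other `n - k`, so the chord
is at least of order `d * min k (n - k)`, and the reciprocal of a minimum is at most the sum of the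
reciprocals. -/
lemma IsC11ia.exists_inv_norm_sub_le {L : ℝ} {γ : ℝ → E3} (hγ : IsC11ia L γ) (hL : 0 < L) :
    ∃ c : ℝ, 0 < c ∧ ∀ (x : ℕ → ℝ) (n : ℕ) (d : ℝ), 0 < d → x 0 = 0 → x n = L →
      (∀ k < n, d ≤ x (k + 1) - x k) → ∀ i < n, ∀ j < n, j ≠ i →
      γ (x j) ≠ γ (x i) ∧ ‖γ (x j) - γ (x i)‖⁻¹ ≤ c / d * cyclicRecip n (Nat.dist i j) := by
  obtain ⟨c, hc, h⟩ := hγ.exists_mul_min_le hL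
  refine ⟨c⁻¹, inv_pos.2 hc, fun x n d hd hx0 hxn hx => ?_⟩
  have key : ∀ i j, i < j → j < n → γ (x i) ≠ γ (x j) ∧
      ‖γ (x i) - γ (x j)‖⁻¹ ≤ c⁻¹ / d * cyclicRecip n (j - i) := by
    intro i j hij hj
    have h1 := mul_sub_le_sub_of_step hx hij.le hj.le
    have h2 := mul_sub_le_sub_of_step hx hj.le le_rfl
    have h3 := mul_sub_le_sub_of_step hx (Nat.zero_le i) (by omega)
    have hk : 0 < ((j - i : ℕ) : ℝ) := by exact_mod_cast Nat.sub_pos_of_lt hij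
    have hk' : 0 < ((n - (j - i) : ℕ) : ℝ) := by exact_mod_cast (by omega : 0 < n - (j - i))
    have e : ((n - (j - i) : ℕ) : ℝ) = ((n - j : ℕ) : ℝ) + ((i - 0 : ℕ) : ℝ) := by
      exact_mod_cast (by omega : n - (j - i) = (n - j) + (i - 0))
    rw [hxn] at h2
    rw [hx0] at h3
    set a := ((j - i : ℕ) : ℝ) with ha
    set b := ((n - (j - i) : ℕ) : ℝ) with hb
    have h4 : d * b ≤ L - (x j - x i) := by rw [e, mul_add]; linarith
    have hm : 0 < min a b := lt_min hk hk'
    have h5 := h (x i) (x j) (d * min a b) (by nlinarith)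
      (le_trans (by gcongr; exact min_le_left _ _) h1)
      (le_trans (by gcongr; exact min_le_right _ _) h4)
    have h6 : 0 < c * (d * min a b) := by positivity
    refine ⟨sub_ne_zero.1 (norm_pos_iff.1 (h6.trans_le h5)), ?_⟩
    calc ‖γ (x i) - γ (x j)‖⁻¹ ≤ (c * (d * min a b))⁻¹ := inv_anti₀ h6 h5
      _ = c⁻¹ / d * (min a b)⁻¹ := by rw [mul_inv, mul_inv]; ring
      _ ≤ c⁻¹ / d * cyclicRecip n (j - i) := by
        gcongr
        rw [cyclicRecip, ← ha, ← hb]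
        rcases le_total a b with hab | hab
        · rw [min_eq_left hab]
          linarith [inv_pos.2 hk']
        · rw [min_eq_right hab]
          linarith [inv_pos.2 hk]
  intro i hi j hj hji
  rcases lt_or_gt_of_ne hji with hlt | hlt
  · have e : Nat.dist i j = i - j := Nat.dist_eq_sub_of_le_right hlt.le
    rw [e]
    exact key j i hlt hi
  · have e : Nat.dist i j = j - i := Nat.dist_eq_sub_of_le hlt.le
    rw [e, norm_sub_rev]
    exact ⟨(key i j hlt hj).1.symm, (key i j hlt hj).2⟩

/-- The tangent-point energy is approximated by off-diagonal Riemann sums up to an error of order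
`log n / n`. -/
lemma IsC11ia.exists_riemann_error_le {L c₁ c₂ q M : ℝ} {γ : ℝ → E3} (hγ : IsC11ia L γ) (hL : 0 < L)
    (hc₁ : 0 < c₁) (hc₂ : 0 < c₂) (hq : 1 ≤ q) (hM0 : 0 < M) (hM : ∀ s t, tpKernel q γ s t ≤ M) :
    ∃ C : ℝ, 0 < C ∧ ∀ (x : ℕ → ℝ) (n : ℕ), 1 ≤ n → x 0 = 0 → x n = L →
      (∀ k < n, c₁ / n ≤ x (k + 1) - x k ∧ x (k + 1) - x k ≤ c₂ / n) →
      |(∫ s in (0 : ℝ)..L, ∫ t in (0 : ℝ)..L, tpKernel q γ s t) -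
        ∑ i ∈ Finset.range n, ∑ j ∈ (Finset.range n).erase i,
          tpKernel q γ (x j) (x i) * ((x (i + 1) - x i) * (x (j + 1) - x j))| ≤
        C * (1 + Real.log n) / n := by
  obtain ⟨_, C, _, hC, _, hlip⟩ := hγ.exists_tpKernel_bounds hL hq
  obtain ⟨c, hc, hinv⟩ := hγ.exists_inv_norm_sub_le hL
  refine ⟨c₂ ^ 2 * (M + 4 * (C * c₂ * (c / c₁))), by positivity, fun x n hn hx0 hxn hx => ?_⟩
  have hn0 : (0 : ℝ) < n := by exact_mod_cast hn
  have hstep : ∀ k < n, x k ≤ x (k + 1) := fun k hk => by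
    have := (hx k hk).1
    have h2 : 0 < c₁ / n := by positivity
    linarith
  have hlog : 0 ≤ Real.log n := Real.log_natCast_nonneg n
  have hB : ∀ i < n, ∀ j < n, j ≠ i → ∀ s ∈ Set.Icc (x j) (x (j + 1)),
      ∀ t ∈ Set.Icc (x i) (x (i + 1)), |tpKernel q γ s t - tpKernel q γ (x j) (x i)| ≤
        C * c₂ * (c / c₁) * cyclicRecip n (Nat.dist i j) := by
    intro i hi j hj hji s hs t ht
    obtain ⟨hne, hle⟩ := hinv x n (c₁ / n) (by positivity) hx0 hxn (fun k hk => (hx k hk).1)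
      i hi j hj hji
    rw [abs_sub_comm]
    refine (hlip (x j) (x i) s t (c₂ / n) ?_ ?_ hne).trans ?_
    · rw [abs_of_nonneg (by linarith [hs.1])]; linarith [hs.2, (hx j hj).2]
    · rw [abs_of_nonneg (by linarith [ht.1])]; linarith [ht.2, (hx i hi).2]
    -- The factor `1 / n` of the displacement cancels against the `n` in the reciprocal chord.
    · rw [div_eq_mul_inv (C * _)]
      calc C * (c₂ / n) * ‖γ (x j) - γ (x i)‖⁻¹
          ≤ C * (c₂ / n) * (c / (c₁ / n) * cyclicRecip n (Nat.dist i j)) := by gcongr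
        _ = _ := by field_simp
  have := abs_integral_sub_offDiagonal_sum_le (hγ.measurable_tpKernel q) (tpKernel_nonneg q γ) hM
    hstep hB
  rw [hx0, hxn] at this
  refine this.trans ?_
  have hterm : ∀ i ∈ Finset.range n, M * (x (i + 1) - x i) ^ 2 + ∑ j ∈ (Finset.range n).erase i,
      C * c₂ * (c / c₁) * cyclicRecip n (Nat.dist i j) * ((x (i + 1) - x i) * (x (j + 1) - x j)) ≤
      (c₂ / n) ^ 2 * (M + 4 * (C * c₂ * (c / c₁))) * (1 + Real.log n) := by
    intro i hi
    have hi' := Finset.mem_range.1 hi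
    have hi0 := sub_nonneg.2 (hstep i hi')
    have h1 : M * (x (i + 1) - x i) ^ 2 ≤ M * (c₂ / n) ^ 2 * (1 + Real.log n) := by
      calc M * (x (i + 1) - x i) ^ 2 ≤ M * (c₂ / n) ^ 2 := by gcongr; exact (hx i hi').2
        _ ≤ _ := le_mul_of_one_le_right (by positivity) (by linarith)
    have h2 : ∑ j ∈ (Finset.range n).erase i, C * c₂ * (c / c₁) * cyclicRecip n (Nat.dist i j) *
        ((x (i + 1) - x i) * (x (j + 1) - x j)) ≤
        ∑ j ∈ (Finset.range n).erase i,
          C * c₂ * (c / c₁) * (c₂ / n) ^ 2 * cyclicRecip n (Nat.dist i j) := by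
      refine Finset.sum_le_sum fun j hj => ?_
      have hj' := Finset.mem_range.1 (Finset.mem_erase.1 hj).2
      have hj0 := sub_nonneg.2 (hstep j hj')
      have hr := cyclicRecip_nonneg n (Nat.dist i j)
      calc _ ≤ C * c₂ * (c / c₁) * cyclicRecip n (Nat.dist i j) * ((c₂ / n) * (c₂ / n)) := by
            gcongr
            · exact (hx i hi').2
            · exact (hx j hj').2
        _ = _ := by ring
    rw [← Finset.mul_sum] at h2
    have h3 := mul_le_mul_of_nonneg_left (sum_cyclicRecip_dist_le hi')
      (by positivity : 0 ≤ C * c₂ * (c / c₁) * (c₂ / n) ^ 2)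
    linarith
  refine (Finset.sum_le_sum hterm).trans (le_of_eq ?_)
  rw [Finset.sum_const, Finset.card_range, nsmul_eq_mul]
  field_simp

/-! ### Exchanging the weights and the final rate -/

lemma abs_sum_mul_sub_sum_mul_le {n : ℕ} {G : ℕ → ℕ → ℝ} {h l : ℕ → ℝ} {M E : ℝ}
    (hE : 0 ≤ E) (hM0 : 0 ≤ M) (hM : ∀ i j, |G i j| ≤ M)
    (hhl : ∀ i < n, ∀ j < n, |h i * h j - l i * l j| ≤ E) :
    |(∑ i ∈ Finset.range n, ∑ j ∈ (Finset.range n).erase i, G i j * (h i * h j)) -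
      ∑ i ∈ Finset.range n, ∑ j ∈ (Finset.range n).erase i, G i j * (l i * l j)| ≤
      n ^ 2 * (M * E) := by
  rw [← Finset.sum_sub_distrib]
  have hin : ∀ i ∈ Finset.range n, |(∑ j ∈ (Finset.range n).erase i, G i j * (h i * h j)) -
      ∑ j ∈ (Finset.range n).erase i, G i j * (l i * l j)| ≤ n * (M * E) := by
    intro i hi
    rw [← Finset.sum_sub_distrib]
    refine (Finset.abs_sum_le_sum_abs _ _).trans ?_
    have : ∀ j ∈ (Finset.range n).erase i, |G i j * (h i * h j) - G i j * (l i * l j)| ≤ M * E := by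
      intro j hj
      rw [← mul_sub, abs_mul]
      have := hhl i (Finset.mem_range.1 hi) j (Finset.mem_range.1 (Finset.mem_erase.1 hj).2)
      gcongr
      exact hM i j
    refine (Finset.sum_le_card_nsmul _ _ _ this).trans ?_
    rw [nsmul_eq_mul]
    gcongr
    exact_mod_cast (Finset.card_erase_le).trans (Finset.card_range n).le
  refine (Finset.abs_sum_le_sum_abs _ _).trans ((Finset.sum_le_card_nsmul _ _ _ hin).trans ?_)
  rw [nsmul_eq_mul, Finset.card_range]
  apply le_of_eq
  ring

lemma abs_mul_sub_mul_le {h l h' l' A e : ℝ} (hh : 0 ≤ h') (hhA : h' ≤ A) (hl : |l| ≤ A + e)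
    (h1 : |l - h| ≤ e) (h2 : |l' - h'| ≤ e) : |h * h' - l * l'| ≤ e * (2 * A + e) := by
  have e1 : h * h' - l * l' = -((l - h) * h') - l * (l' - h') := by ring
  have he : 0 ≤ e := (abs_nonneg _).trans h1
  rw [e1]
  refine (abs_sub _ _).trans ?_
  rw [abs_neg, abs_mul, abs_mul, abs_of_nonneg hh]
  have h3 : |l - h| * h' ≤ e * A := by gcongr
  have h4 : |l| * |l' - h'| ≤ (A + e) * e := by gcongr; exact (abs_nonneg l).trans hl
  linarith

lemma one_add_log_div_le {ε : ℝ} (hε : 0 < ε) {n : ℕ} (hn : 1 ≤ n) :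
    (1 + Real.log n) / n ≤ (1 + 1 / ε) / (n : ℝ) ^ (1 - ε) := by
  have hn0 : (0 : ℝ) < n := by exact_mod_cast hn
  have h1 : Real.log n ≤ (n : ℝ) ^ ε / ε := Real.log_le_rpow_div hn0.le hε
  have h2 : (1 : ℝ) ≤ (n : ℝ) ^ ε := Real.one_le_rpow (by exact_mod_cast hn) hε.le
  rw [Real.rpow_sub hn0, Real.rpow_one, div_div_eq_mul_div]
  gcongr
  calc 1 + Real.log n ≤ (n : ℝ) ^ ε + (n : ℝ) ^ ε / ε := add_le_add h2 h1
    _ = _ := by ring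

end

theorem theorem3p1 (q L c₁ c₂ : ℝ) (hq : 2 ≤ q) (hL : 0 < L) (hc₁ : 0 < c₁) (hc₂ : 0 < c₂)
    (γ : ℝ → E3) (hγ : IsC11ia L γ)
    (s : ℕ → ℕ → ℝ) (hs : IsDistributed L c₁ c₂ s)
    (n₀ : ℕ) (β : ℕ → MarkedCurve)
    (hβ : ∀ n, n₀ ≤ n → β n ∈ MarkedCurve.biarcCurves n)
    (hproper : ∀ n, n₀ ≤ n → (β n).IsProper n)
    (hbalanced : ∀ n, n₀ ≤ n → (β n).IsInterpolatingBalanced n γ)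
    (hinterp : ∀ n, n₀ ≤ n → ∀ i < n, (β n).InterpolatesAt γ i (s n i) (s n (i + 1))) :
    tangentPointEnergy q L γ ≠ ⊤ ∧
    ∃ N : ℕ, ∀ ε : ℝ, 0 < ε → ∃ C : ℝ, 0 < C ∧ ∀ n : ℕ, N ≤ n →
      (β n).discreteEnergy q n ≠ ⊤ ∧
      |(tangentPointEnergy q L γ).toReal - ((β n).discreteEnergy q n).toReal| ≤
        C / (n : ℝ) ^ (1 - ε) := by
  obtain ⟨M, _, hM0, _, hM, _⟩ := hγ.exists_tpKernel_bounds hL (by linarith : 1 ≤ q)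
  obtain ⟨C₁, hC₁, hRiem⟩ := hγ.exists_riemann_error_le hL hc₁ hc₂ (by linarith : 1 ≤ q) hM0 hM
  obtain ⟨C₂, h₀, hC₂, hh₀, hlen⟩ := hγ.exists_abs_biarcLen_sub_le
  have hTP := tangentPointEnergy_eq_ofReal hL hγ hM
  have hI0 : 0 ≤ ∫ s in (0 : ℝ)..L, ∫ t in (0 : ℝ)..L, tpKernel q γ s t :=
    intervalIntegral.integral_nonneg hL.le fun s _ =>
      intervalIntegral.integral_nonneg hL.le fun t _ => tpKernel_nonneg q γ s t
  refine ⟨by rw [hTP]; exact ENNReal.ofReal_ne_top, ?_⟩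
  obtain ⟨N, hN⟩ := exists_nat_ge (c₂ / h₀)
  -- This index ensures that the biarcs and the partition exist and that the mesh is below the
  -- threshold `h₀`; none of this involves `ε`.
  refine ⟨max (max n₀ 2) N, fun ε hε => ?_⟩
  set C₃ := M * (C₂ * c₂ ^ 2 * (2 * c₂ + C₂ * c₂ ^ 2)) with hC₃
  have hC₃0 : 0 < C₃ := by positivity
  refine ⟨(C₁ + C₃) * (1 + 1 / ε), by positivity, fun n hn => ?_⟩
  have hn₀ : n₀ ≤ n := le_trans (le_trans (le_max_left _ _) (le_max_left _ _)) hn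
  have hn2 : 2 ≤ n := le_trans (le_trans (le_max_right _ _) (le_max_left _ _)) hn
  have hnN : N ≤ n := le_trans (le_max_right _ _) hn
  have hn0 : (0 : ℝ) < n := by exact_mod_cast (by omega : 0 < n)
  have hn1 : (1 : ℝ) ≤ n := by exact_mod_cast (by omega : 1 ≤ n)
  have hmesh : c₂ / n ≤ h₀ := by
    have h1 : c₂ / h₀ ≤ n := hN.trans (by exact_mod_cast hnN)
    rw [div_le_iff₀ hh₀] at h1
    rw [div_le_iff₀ hn0]
    linarith
  obtain ⟨hs0, hsL, hsk⟩ := hs n hn2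
  have hpt : ∀ i < n, (β n).pt i = γ (s n i) ∧ (β n).tan i = deriv γ (s n i) := fun i hi =>
    ⟨(hinterp n hn₀ i hi).1, (hinterp n hn₀ i hi).2.1⟩
  have hlen' : ∀ i < n, |(β n).biarcLen i - (s n (i + 1) - s n i)| ≤ C₂ * c₂ ^ 2 / n ^ 2 := by
    intro i hi
    obtain ⟨h1, -, h3, -⟩ := hsk i hi
    obtain ⟨-, hsig, hbal⟩ := hbalanced n hn₀ i hi
    refine (hlen n (β n) i _ _ (hβ n hn₀) hi h1 (h3.trans hmesh) (hinterp n hn₀ i hi) hsig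
      hbal).trans ?_
    have h4 : 0 ≤ s n (i + 1) - s n i := by linarith
    calc C₂ * (s n (i + 1) - s n i) ^ 2 ≤ C₂ * (c₂ / n) ^ 2 := by gcongr
      _ = _ := by ring
  have hl0 : ∀ i < n, 0 ≤ (β n).biarcLen i := by
    intro i hi
    obtain ⟨-, -, -, -, hbi⟩ := hβ n hn₀
    exact arcLen_nonneg _ ((hbi i hi).1.trans (hbi i hi).2.1).le
  have hE : (β n).discreteEnergy q n = ENNReal.ofReal (∑ i ∈ Finset.range n,
      ∑ j ∈ (Finset.range n).erase i,
        tpKernel q γ (s n j) (s n i) * ((β n).biarcLen i * (β n).biarcLen j)) := by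
    rw [MarkedCurve.discreteEnergy, if_pos (hβ n hn₀)]
    congr 1
    refine Finset.sum_congr rfl fun i hi => Finset.sum_congr rfl fun j hj => ?_
    have hi' := Finset.mem_range.1 hi
    have hj' := Finset.mem_range.1 (Finset.mem_erase.1 hj).2
    rw [(hpt i hi').1, (hpt j hj').1, (hpt j hj').2, tpKernel]
  refine ⟨by rw [hE]; exact ENNReal.ofReal_ne_top, ?_⟩
  rw [hE, hTP, ENNReal.toReal_ofReal hI0, ENNReal.toReal_ofReal (Finset.sum_nonneg fun i hi =>
    Finset.sum_nonneg fun j hj => mul_nonneg (tpKernel_nonneg _ _ _ _)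
      (mul_nonneg (hl0 i (Finset.mem_range.1 hi))
        (hl0 j (Finset.mem_range.1 (Finset.mem_erase.1 hj).2))))]
  have hR := hRiem (s n) n (by omega) hs0 hsL fun k hk => ⟨(hsk k hk).2.1, (hsk k hk).2.2.1⟩
  have hS := abs_sum_mul_sub_sum_mul_le (n := n) (G := fun i j => tpKernel q γ (s n j) (s n i))
    (h := fun i => s n (i + 1) - s n i) (l := fun i => (β n).biarcLen i) (M := M)
    (E := C₂ * c₂ ^ 2 * (2 * c₂ + C₂ * c₂ ^ 2) / n ^ 3) (by positivity) hM0.le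
    (fun i j => by rw [abs_of_nonneg (tpKernel_nonneg _ _ _ _)]; exact hM _ _)
    (by
      intro i hi j hj
      have h1 := hlen' i hi
      have h2 := hlen' j hj
      have h3 : |(β n).biarcLen i| ≤ c₂ / n + C₂ * c₂ ^ 2 / n ^ 2 := by
        rw [abs_of_nonneg (hl0 i hi)]
        linarith [(abs_le.1 h1).2, (hsk i hi).2.2.1]
      refine (abs_mul_sub_mul_le (by linarith [(hsk j hj).1]) (hsk j hj).2.2.1 h3 h1 h2).trans ?_
      -- Weakening one `n⁻²` to `n⁻¹` makes the bound a single multiple of `n⁻³`, the value chosen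
      -- for `E`.
      have h4 : C₂ * c₂ ^ 2 / (n : ℝ) ^ 2 ≤ C₂ * c₂ ^ 2 / n := by
        gcongr
        exact le_self_pow₀ hn1 two_ne_zero
      calc C₂ * c₂ ^ 2 / (n : ℝ) ^ 2 * (2 * (c₂ / n) + C₂ * c₂ ^ 2 / n ^ 2)
          ≤ C₂ * c₂ ^ 2 / (n : ℝ) ^ 2 * (2 * (c₂ / n) + C₂ * c₂ ^ 2 / n) := by gcongr
        _ = _ := by field_simp)
  have hS' : (n : ℝ) ^ 2 * (M * (C₂ * c₂ ^ 2 * (2 * c₂ + C₂ * c₂ ^ 2) / n ^ 3)) = C₃ / n := by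
    rw [hC₃]; field_simp
  rw [hS'] at hS
  have hlog : 0 ≤ Real.log n := Real.log_natCast_nonneg n
  have hS2 : C₃ / n ≤ C₃ * (1 + Real.log n) / n := by
    gcongr
    exact le_mul_of_one_le_right hC₃0.le (by linarith)
  refine (abs_sub_le _ _ _).trans ((add_le_add hR (hS.trans hS2)).trans ?_)
  calc C₁ * (1 + Real.log n) / n + C₃ * (1 + Real.log n) / n
      = (C₁ + C₃) * ((1 + Real.log n) / n) := by ring
    _ ≤ (C₁ + C₃) * ((1 + 1 / ε) / (n : ℝ) ^ (1 - ε)) := by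
      exact mul_le_mul_of_nonneg_left (one_add_log_div_le hε (one_le_two.trans hn2)) (by positivity)
    _ = _ := by ring
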